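/- Let $\Phi:[0,\infty)\to[0,\infty)$ be a (strictly) increasing convex function with $\Phi(0)=0$ such that $\sqrt{\Phi}$ is concave and $\Phi$ is $\mathcal C^2$ on $[\Phi^{-1}(1),\infty)$. Let $\mu_\Phi$ be the probability measure on $\mathbb R$ given by $d\mu_\Phi(x)=Z_\Phi^{-1}e^{-\Phi(|x|)}\,dx$ with $Z_\Phi=\int_{\mathbb R}e^{-\Phi(|x|)}\,dx$, and let $\mu_\Phi^n$ be its $n$-fold product on $\mathbb R^n$. Define $$T(x)=\left[\frac{1}{\Phi'(\Phi^{-1}(1/x))}\right]^2\quad (x>0),$$ and $$\beta(s)=\left[\frac{1}{\Phi'(\Phi^{-1}(\log(1+s)))}\right]^2\ \ (s\ge e-1),\qquad \beta(s)=\left[\frac{1}{\Phi'(\Phi^{-1}(1))}\right]^2\ \ (1\le s\le e-1).$$ Then there is a constant $C>0$, depending only on $\Phi$, such that for every $n\ge 1$ and every $\mathcal C^\infty$ function $f:\mathbb R^n\to\mathbb R$, $$\sup_{p\in(1,2)}\frac{\int f^2\,d\mu_\Phi^n-\left(\int|f|^p\,d\mu_\Phi^n\right)^{2/p}}{T(2-p)}\le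 C\int|\nabla f|^2\,d\mu_\Phi^n ,$$ and, with the same $C$, for every $n\ge1$, every $\mathcal C^\infty$ function $f:\mathbb R^n\to\mathbb R$ and every $s\ge1$, $$\int f^2\,d\mu_\Phi^n-s\left(\int|f|\,d\mu_\Phi^n\right)^2\le 48\,C\,\beta(s)\int|\nabla f|^2\,d\mu_\Phi^n .$$ Here all integrals are of nonnegative functions and take values in $[0,\infty]$, and an inequality $\frac{a-b}{t}\le c$ with $t>0$ is understood as $a\le b+tc$. -/

import Mathlib

open Set MeasureTheory
open scoped ContDiff

noncomputable section

/-- Hypotheses on the potential `Φ : [0,∞) → [0,∞)`, given as a function on `ℝ` of which only the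
restriction to `[0,∞)` matters: it is convex, increasing, vanishes at `0`, `√Φ` is concave. -/
structure IsPotential (Φ : ℝ → ℝ) : Prop where
  convex : ConvexOn ℝ (Ici 0) Φ
  increasing : StrictMonoOn Φ (Ici 0)
  zero : Φ 0 = 0
  sqrt_concave : ConcaveOn ℝ (Ici 0) (fun x => Real.sqrt (Φ x))

/-- The inverse `Φ⁻¹ : [0,∞) → [0,∞)` of `Φ : [0,∞) → [0,∞)`. -/
def potentialInv (Φ : ℝ → ℝ) (y : ℝ) : ℝ := Function.invFunOn Φ (Ici 0) y

/-- The normalizing constant `Z_Φ = ∫ exp (-Φ(|x|)) dx`. -/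
def partitionConst (Φ : ℝ → ℝ) : ℝ := ∫ x : ℝ, Real.exp (-Φ |x|)

/-- The measure `dμ_Φ(x) = Z_Φ⁻¹ exp (-Φ(|x|)) dx` on the real line. -/
def potentialMeasure (Φ : ℝ → ℝ) : Measure ℝ :=
  (volume : Measure ℝ).withDensity
    (fun x => ENNReal.ofReal ((partitionConst Φ)⁻¹ * Real.exp (-Φ |x|)))

/-- The `n`-fold product measure `μ_Φⁿ` on `ℝⁿ`. -/
def potentialProd (Φ : ℝ → ℝ) (n : ℕ) : Measure (Fin n → ℝ) :=
  Measure.pi (fun _ : Fin n => potentialMeasure Φ)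

/-- `T(x) = [1 / Φ'(Φ⁻¹(1/x))]²` for `x > 0`. -/
def becknerRate (Φ : ℝ → ℝ) (x : ℝ) : ℝ := (1 / deriv Φ (potentialInv Φ (1 / x))) ^ 2

open Classical in
/-- `β(s) = [1 / Φ'(Φ⁻¹(log (1+s)))]²` for `s ≥ e - 1`, and `β(s) = [1 / Φ'(Φ⁻¹(1))]²` for
`s ∈ [1, e - 1]`. -/
def superPoincareRate (Φ : ℝ → ℝ) (s : ℝ) : ℝ :=
  if Real.exp 1 - 1 ≤ s then (1 / deriv Φ (potentialInv Φ (Real.log (1 + s)))) ^ 2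
  else (1 / deriv Φ (potentialInv Φ 1)) ^ 2

/-- `|∇f(x)|²`, the sum of the squares of the partial derivatives of `f` at `x`. -/
def gradSq {n : ℕ} (f : (Fin n → ℝ) → ℝ) (x : Fin n → ℝ) : ℝ :=
  ∑ i : Fin n, (fderiv ℝ f x (Pi.single i 1)) ^ 2

/-- The Dirichlet energy `∫ |∇f|² dμ`, in `[0,∞]`. -/
def energy {n : ℕ} (μ : Measure (Fin n → ℝ)) (f : (Fin n → ℝ) → ℝ) : ENNReal :=
  ∫⁻ x, ENNReal.ofReal (gradSq f x) ∂μ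

/-- The moment `∫ |f|^p dμ`, in `[0,∞]`. -/
def absMoment {n : ℕ} (μ : Measure (Fin n → ℝ)) (p : ℝ) (f : (Fin n → ℝ) → ℝ) : ENNReal :=
  ∫⁻ x, ENNReal.ofReal (|f x| ^ p) ∂μ

/-- Beckner-type inequality with rate `T` and constant `C`: for every smooth `f`,
`sup_{p ∈ (1,2)} (∫ f² dμ - (∫ |f|^p dμ)^(2/p)) / T(2-p) ≤ C ∫ |∇f|² dμ`.
Everything is in `[0,∞]`, where `a - b ≤ c` means `a ≤ c + b`, also for infinite values. -/
def BecknerInequality {n : ℕ} (μ : Measure (Fin n → ℝ)) (T : ℝ → ℝ) (C : ℝ) : Prop :=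
  ∀ f : (Fin n → ℝ) → ℝ, ContDiff ℝ ∞ f →
    (⨆ p ∈ Ioo (1 : ℝ) 2,
      (absMoment μ 2 f - (absMoment μ p f) ^ (2 / p)) / ENNReal.ofReal (T (2 - p)))
      ≤ ENNReal.ofReal C * energy μ f

/-- Super-Poincaré inequality with rate `β`: for every smooth `f` and every `s ≥ 1`,
`∫ f² dμ - s (∫ |f| dμ)² ≤ β(s) ∫ |∇f|² dμ`. Everything is in `[0,∞]`, where `a - b ≤ c` means
`a ≤ c + b`, also for infinite values. -/
def SuperPoincareInequality {n : ℕ} (μ : Measure (Fin n → ℝ)) (β : ℝ → ℝ) : Prop :=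
  ∀ f : (Fin n → ℝ) → ℝ, ContDiff ℝ ∞ f → ∀ s : ℝ, 1 ≤ s →
    absMoment μ 2 f - ENNReal.ofReal s * (absMoment μ 1 f) ^ 2
      ≤ ENNReal.ofReal (β s) * energy μ f

end

/-! The Beckner inequality is proved on the line and tensorized; one exponent `p` for each `s` then
gives the super-Poincaré inequality.

On the line, take f > 0 and put m² = ∫ f², E = ∫ f'², a = 2 - p. Expanding around m bounds m² - (∫
f^p)^(2/p) by 8 ∫ (f - m)² min(1, a (1 + log⁺(f/m))) (`sq_sub_rpow_le`, `sq_add_le_rpow`). The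
pointwise bound f² ≤ K (m² + E) exp Φ replaces the logarithm by K + E/m² + Φ. The constant part is
then a Poincaré inequality, since a is at most a multiple of T(a). What remains is ∫ (f - m)² min(1,
aΦ).

This is the heart of the proof, the weighted Hardy inequality `weight_half`. Let R = Φ⁻¹(1/a) and D
= Φ'(R), so that T(a) = 1/D². Concavity of √Φ makes Φ'/√Φ nonincreasing, so Φ' ≥ D √(aΦ) before R;
convexity gives Φ' ≥ D after R. Hence Φ' dominates D √min(1, aΦ), and integrating the derivative of
f² D √min(1, aΦ) exp(-Φ) bounds D² ∫ f² min(1, aΦ) by a multiple of ∫ (f² + f'²), uniformly in a.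

For the product, the line inequality is used in one variable and the induction hypothesis on the
partial L^p norm g in that variable: ∫ g^p = ∫ f^p and (∂ᵢg)² ≤ ∫ (∂ᵢf)², so the constant does not
grow with n. Positivity and boundedness are removed by √(f² + ε²), truncation and Fatou's lemma.

With x = ∫ f², y = (∫ |f|)² and θ = (2 - p)/p, Hölder gives x ≤ y^θ x^(1-θ) + C T(2 - p) ∫ |∇f|².
For p = 2 - 1/log(1 + s) the rate is β(s) and s^θ stays away from 1, so either x ≤ s y or the first
term is a fixed fraction of x. For s ≤ e - 1 let p tend to 1. -/

open Filter Topology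

/-! ### Potentials, their inverses and their measures -/

namespace IsPotential

variable {Φ : ℝ → ℝ}

theorem nonneg (h : IsPotential Φ) {x : ℝ} (hx : 0 ≤ x) : 0 ≤ Φ x := by
  have := h.increasing.monotoneOn (mem_Ici.2 le_rfl) (mem_Ici.2 hx) hx
  rwa [h.zero] at this

theorem pos (h : IsPotential Φ) {x : ℝ} (hx : 0 < x) : 0 < Φ x := by
  have := h.increasing (mem_Ici.2 le_rfl) (mem_Ici.2 hx.le) hx
  rwa [h.zero] at this

theorem mul_le (h : IsPotential Φ) {t x : ℝ} (ht : 0 ≤ t) (ht1 : t ≤ 1) (hx : 0 ≤ x) :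
    Φ (t * x) ≤ t * Φ x := by
  have := h.convex.2 (mem_Ici.2 hx) (mem_Ici.2 le_rfl) ht (sub_nonneg.2 ht1) (by ring)
  simpa [h.zero] using this

theorem add_le (h : IsPotential Φ) {x y : ℝ} (hx : 0 ≤ x) (hy : 0 ≤ y) :
    Φ x + Φ y ≤ Φ (x + y) := by
  rcases hx.eq_or_lt with rfl | hx'
  · simp [h.zero]
  have hs : 0 < x + y := by linarith
  have h1 := h.mul_le (t := x / (x + y)) (x := x + y) (by positivity)
    ((div_le_one hs).2 (by linarith)) hs.le
  have h2 := h.mul_le (t := y / (x + y)) (x := x + y) (by positivity)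
    ((div_le_one hs).2 (by linarith)) hs.le
  rw [div_mul_cancel₀ _ hs.ne'] at h1 h2
  calc Φ x + Φ y ≤ x / (x + y) * Φ (x + y) + y / (x + y) * Φ (x + y) := add_le_add h1 h2
    _ = Φ (x + y) := by field_simp

/-- Convexity of Φ orders the one-sided derivatives one way; concavity of √Φ, through the chain
rule, orders them the other way. -/
theorem hasDerivAt (h : IsPotential Φ) {x : ℝ} (hx : 0 < x) : HasDerivAt Φ (deriv Φ x) x := by
  have hi : x ∈ interior (Ici (0 : ℝ)) := by simpa using hx
  have hr := h.convex.hasDerivWithinAt_rightDeriv_of_mem_interior hi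
  have hl := h.convex.hasDerivWithinAt_leftDeriv_of_mem_interior hi
  have hlr := h.convex.leftDeriv_le_rightDeriv_of_mem_interior hi
  have hn : ConvexOn ℝ (Ici 0) (-fun x => Real.sqrt (Φ x)) := h.sqrt_concave.neg
  have hlr' := hn.leftDeriv_le_rightDeriv_of_mem_interior hi
  have hp := h.pos hx
  have e1 : derivWithin (-fun x => Real.sqrt (Φ x)) (Ioi x) x =
      -(derivWithin Φ (Ioi x) x / (2 * Real.sqrt (Φ x))) :=
    ((hr.sqrt hp.ne').neg).derivWithin (uniqueDiffWithinAt_Ioi x)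
  have e2 : derivWithin (-fun x => Real.sqrt (Φ x)) (Iio x) x =
      -(derivWithin Φ (Iio x) x / (2 * Real.sqrt (Φ x))) :=
    ((hl.sqrt hp.ne').neg).derivWithin (uniqueDiffWithinAt_Iio x)
  rw [e1, e2, neg_le_neg_iff, div_le_div_iff_of_pos_right
    (mul_pos two_pos (Real.sqrt_pos.2 hp))] at hlr'
  have he := le_antisymm hlr hlr'
  rw [he] at hl
  have : HasDerivAt Φ (derivWithin Φ (Ioi x) x) x := by
    have hu := hl.Iic_of_Iio.union hr.Ici_of_Ioi
    rwa [Iic_union_Ici, hasDerivWithinAt_univ] at hu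
  exact this.differentiableAt.hasDerivAt

theorem monotoneOn_deriv (h : IsPotential Φ) : MonotoneOn (deriv Φ) (Ioi 0) :=
  (h.convex.subset Ioi_subset_Ici_self (convex_Ioi 0)).monotoneOn_deriv
    fun _ hx => (h.hasDerivAt hx).differentiableAt

/-- The quotient is twice the derivative of √Φ. This is how concavity of √Φ enters the Hardy
inequality. -/
theorem antitoneOn_deriv_div_sqrt (h : IsPotential Φ) :
    AntitoneOn (fun x => deriv Φ x / Real.sqrt (Φ x)) (Ioi 0) := by
  have hd : ∀ x ∈ Ioi (0 : ℝ), HasDerivAt (fun x => Real.sqrt (Φ x))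
      (deriv Φ x / (2 * Real.sqrt (Φ x))) x :=
    fun x hx => (h.hasDerivAt hx).sqrt (h.pos hx).ne'
  have := (h.sqrt_concave.subset Ioi_subset_Ici_self (convex_Ioi 0)).antitoneOn_deriv
    fun x hx => (hd x hx).differentiableAt
  intro x hx y hy hxy
  have h1 := this hx hy hxy
  rw [(hd x hx).deriv, (hd y hy).deriv] at h1
  have e : ∀ z, deriv Φ z / Real.sqrt (Φ z) = 2 * (deriv Φ z / (2 * Real.sqrt (Φ z))) := by
    intro z; ring
  simp only [e]
  linarith

theorem deriv_pos (h : IsPotential Φ) {x : ℝ} (hx : 0 < x) : 0 < deriv Φ x := by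
  have h0 := h.convex.slope_le_of_hasDerivAt (mem_Ici.2 le_rfl) (mem_Ici.2 hx.le) hx
    (h.hasDerivAt hx)
  refine lt_of_lt_of_le ?_ h0
  rw [slope_def_field, h.zero]
  simpa using div_pos (h.pos hx) hx

theorem continuousOn (h : IsPotential Φ) : ContinuousOn Φ (Ici 0) := by
  intro x hx
  rcases (mem_Ici.1 hx).eq_or_lt with rfl | hx'
  · have h1 : Tendsto (fun t : ℝ => t * Φ 1) (𝓝[Ici 0] 0) (𝓝 0) := by
      have : Continuous fun t : ℝ => t * Φ 1 := by fun_prop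
      simpa using (this.tendsto 0).mono_left nhdsWithin_le_nhds
    rw [ContinuousWithinAt, h.zero]
    refine tendsto_of_tendsto_of_tendsto_of_le_of_le' tendsto_const_nhds h1 ?_ ?_
    · filter_upwards [self_mem_nhdsWithin] with t ht using h.nonneg ht
    · filter_upwards [self_mem_nhdsWithin, nhdsWithin_le_nhds (Iic_mem_nhds zero_lt_one)]
        with t ht ht1
      simpa using h.mul_le ht ht1 zero_le_one
  · exact (h.hasDerivAt hx').continuousAt.continuousWithinAt

/-- At least linear growth makes Φ onto [0,∞) and exp(-Φ) integrable. -/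
theorem linear_le (h : IsPotential Φ) {x : ℝ} (hx : 0 ≤ x) : Φ 1 * x - Φ 1 ≤ Φ x := by
  rcases le_total x 1 with h1 | h1
  · have := h.nonneg hx
    have := (h.pos one_pos).le
    nlinarith
  · have hx0 : 0 < x := by linarith
    have := h.mul_le (t := 1 / x) (x := x) (by positivity) ((div_le_one hx0).2 h1) hx
    rw [one_div_mul_cancel hx0.ne', one_div, inv_mul_eq_div, le_div_iff₀ hx0] at this
    have := (h.pos one_pos).le
    linarith

theorem exists_eq (h : IsPotential Φ) {y : ℝ} (hy : 0 ≤ y) : ∃ x ∈ Ici (0 : ℝ), Φ x = y := by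
  have h1 := h.pos one_pos
  set b := y / Φ 1 + 1
  have hb : 0 ≤ b := by positivity
  have hyb : y ≤ Φ b := by
    have := h.linear_le hb
    have e : Φ 1 * b - Φ 1 = y := by simp only [b]; field_simp; ring
    linarith
  obtain ⟨x, hx, hxy⟩ := intermediate_value_Icc hb (h.continuousOn.mono Icc_subset_Ici_self)
    (show y ∈ Icc (Φ 0) (Φ b) from ⟨by rwa [h.zero], hyb⟩)
  exact ⟨x, hx.1, hxy⟩

theorem apply_inv (h : IsPotential Φ) {y : ℝ} (hy : 0 ≤ y) : Φ (potentialInv Φ y) = y :=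
  Function.invFunOn_eq (h.exists_eq hy)

theorem inv_nonneg (h : IsPotential Φ) {y : ℝ} (hy : 0 ≤ y) : 0 ≤ potentialInv Φ y :=
  Function.invFunOn_mem (h.exists_eq hy)

theorem inv_pos (h : IsPotential Φ) {y : ℝ} (hy : 0 < y) : 0 < potentialInv Φ y := by
  refine lt_of_le_of_ne (h.inv_nonneg hy.le) fun he => ?_
  have := h.apply_inv hy.le
  rw [← he, h.zero] at this
  exact hy.ne this

theorem le_iff_le (h : IsPotential Φ) {x y : ℝ} (hx : 0 ≤ x) (hy : 0 ≤ y) : Φ x ≤ Φ y ↔ x ≤ y :=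
  h.increasing.le_iff_le hx hy

theorem inv_mono (h : IsPotential Φ) {y z : ℝ} (hy : 0 ≤ y) (hyz : y ≤ z) :
    potentialInv Φ y ≤ potentialInv Φ z := by
  rw [← h.le_iff_le (h.inv_nonneg hy) (h.inv_nonneg (hy.trans hyz)), h.apply_inv hy,
    h.apply_inv (hy.trans hyz)]
  exact hyz

theorem continuous_exp (h : IsPotential Φ) : Continuous fun x : ℝ => Real.exp (-Φ |x|) :=
  (h.continuousOn.comp_continuous continuous_abs fun x => abs_nonneg x).neg.rexp

theorem integrableOn_exp (h : IsPotential Φ) :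
    IntegrableOn (fun x : ℝ => Real.exp (-Φ |x|)) (Ioi 0) := by
  have h1 : IntegrableOn (fun x : ℝ => Real.exp (Φ 1) * Real.exp (-Φ 1 * x)) (Ioi 0) :=
    (integrableOn_exp_mul_Ioi (neg_neg_of_pos (h.pos one_pos)) 0).const_mul _
  refine Integrable.mono' h1 h.continuous_exp.aestronglyMeasurable ?_
  filter_upwards [ae_restrict_mem measurableSet_Ioi] with x hx
  rw [Real.norm_of_nonneg (Real.exp_pos _).le, ← Real.exp_add, Real.exp_le_exp, abs_of_pos hx]
  have := h.linear_le (le_of_lt hx)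
  linarith

theorem integrable_exp (h : IsPotential Φ) : Integrable fun x : ℝ => Real.exp (-Φ |x|) := by
  rw [← integrableOn_univ, ← Iic_union_Ioi (a := (0 : ℝ)), integrableOn_union]
  refine ⟨?_, h.integrableOn_exp⟩
  have := h.integrableOn_exp.comp_neg
  simpa [integrableOn_Iic_iff_integrableOn_Iio] using this

theorem partitionConst_pos (h : IsPotential Φ) : 0 < partitionConst Φ := by
  refine (integral_pos_iff_support_of_nonneg (fun x => (Real.exp_pos _).le) h.integrable_exp).2 ?_
  have : Function.support (fun x : ℝ => Real.exp (-Φ |x|)) = univ := by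
    ext x; simp [Real.exp_ne_zero]
  simp [this]

theorem isProbabilityMeasure (h : IsPotential Φ) : IsProbabilityMeasure (potentialMeasure Φ) := by
  constructor
  have hZ := h.partitionConst_pos
  rw [potentialMeasure, withDensity_apply _ MeasurableSet.univ, Measure.restrict_univ,
    ← ofReal_integral_eq_lintegral_ofReal (h.integrable_exp.const_mul _)
      (ae_of_all _ fun x => mul_nonneg (_root_.inv_pos.2 hZ).le (Real.exp_pos _).le),
    integral_const_mul]
  change ENNReal.ofReal ((partitionConst Φ)⁻¹ * partitionConst Φ) = 1
  rw [inv_mul_cancel₀ hZ.ne', ENNReal.ofReal_one]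

theorem integral_eq (h : IsPotential Φ) (F : ℝ → ℝ) :
    ∫ x, F x ∂potentialMeasure Φ = (partitionConst Φ)⁻¹ * ∫ x, F x * Real.exp (-Φ |x|) := by
  have hZ := h.partitionConst_pos
  rw [potentialMeasure, integral_withDensity_eq_integral_toReal_smul₀, ← integral_const_mul]
  · refine integral_congr_ae (ae_of_all _ fun x => ?_)
    simp only [smul_eq_mul]
    rw [ENNReal.toReal_ofReal (mul_nonneg (_root_.inv_pos.2 hZ).le (Real.exp_pos _).le)]
    ring
  · exact (h.continuous_exp.measurable.const_mul _).ennreal_ofReal.aemeasurable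
  · exact ae_of_all _ fun x => ENNReal.ofReal_lt_top

end IsPotential

/-! ### Trace bounds and a Poincaré inequality on the half-line -/

/-- A lower bound for the integral of a majorant of the derivative of a nonnegative function. -/
theorem neg_le_integral_Ioi_of_hasDeriv_right_le {H H' φ : ℝ → ℝ} {a : ℝ}
    (hc : ContinuousOn H (Ici a)) (hd : ∀ x, a < x → HasDerivWithinAt H (H' x) (Ioi x) x)
    (hle : ∀ x, a < x → H' x ≤ φ x) (hφ : IntegrableOn φ (Ioi a)) (h0 : ∀ x, a ≤ x → 0 ≤ H x) :
    -H a ≤ ∫ x in Ioi a, φ x := by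
  refine ge_of_tendsto (intervalIntegral_tendsto_integral_Ioi a hφ tendsto_id) ?_
  filter_upwards [eventually_ge_atTop a] with b hb
  have := intervalIntegral.sub_le_integral_of_hasDeriv_right_of_le hb
    (hc.mono Icc_subset_Ici_self) (fun x hx => hd x hx.1)
    ((integrableOn_Icc_iff_integrableOn_Ioc).2 (hφ.mono_set Ioc_subset_Ioi_self))
    fun x hx => hle x hx.1
  have := h0 b hb
  simp only [id]
  linarith

/-- `f` is `C¹` with derivative `f'`, and both are bounded by `M`. -/
structure BddDeriv (f f' : ℝ → ℝ) (M : ℝ) : Prop where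
  hasDerivAt : ∀ x, HasDerivAt f (f' x) x
  cont' : Continuous f'
  bound : ∀ x, |f x| ≤ M
  bound' : ∀ x, |f' x| ≤ M

namespace BddDeriv

variable {f f' : ℝ → ℝ} {M : ℝ}

theorem cont (hf : BddDeriv f f' M) : Continuous f :=
  continuous_iff_continuousAt.2 fun x => (hf.hasDerivAt x).continuousAt

theorem sub_const (hf : BddDeriv f f' M) (c : ℝ) :
    BddDeriv (fun x => f x - c) f' (M + |c|) where
  hasDerivAt x := (hf.hasDerivAt x).sub_const c
  cont' := hf.cont'
  bound x := (abs_sub _ _).trans (by linarith [hf.bound x])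
  bound' x := by linarith [hf.bound' x, abs_nonneg c]

theorem comp_neg (hf : BddDeriv f f' M) :
    BddDeriv (fun x => f (-x)) (fun x => -f' (-x)) M where
  hasDerivAt x := ((hf.hasDerivAt (-x)).comp x (hasDerivAt_neg x)).congr_deriv (by ring)
  cont' := (hf.cont'.comp continuous_neg).neg
  bound x := hf.bound _
  bound' x := by simpa using hf.bound' (-x)

theorem sq_le (hf : BddDeriv f f' M) (x : ℝ) : f x ^ 2 ≤ M ^ 2 :=
  sq_le_sq' (neg_le_of_abs_le (hf.bound x)) (le_of_abs_le (hf.bound x))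

theorem sq_le' (hf : BddDeriv f f' M) (x : ℝ) : f' x ^ 2 ≤ M ^ 2 :=
  sq_le_sq' (neg_le_of_abs_le (hf.bound' x)) (le_of_abs_le (hf.bound' x))

end BddDeriv

namespace IsPotential

variable {Φ : ℝ → ℝ} {f f' : ℝ → ℝ} {M : ℝ}

theorem integrable_mul (h : IsPotential Φ) {F : ℝ → ℝ} (hF : Continuous F) {B : ℝ}
    (hB : ∀ x, |F x| ≤ B) : Integrable (fun x => F x * Real.exp (-Φ |x|)) :=
  h.integrable_exp.bdd_mul hF.aestronglyMeasurable (ae_of_all _ hB)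

theorem integrable_sq (h : IsPotential Φ) (hf : BddDeriv f f' M) :
    Integrable (fun x => f x ^ 2 * Real.exp (-Φ |x|)) :=
  h.integrable_mul (hf.cont.pow 2) fun x => by rw [abs_of_nonneg (sq_nonneg _)]; exact hf.sq_le x

theorem integrable_sq' (h : IsPotential Φ) (hf : BddDeriv f f' M) :
    Integrable (fun x => f' x ^ 2 * Real.exp (-Φ |x|)) :=
  h.integrable_mul (hf.cont'.pow 2) fun x => by rw [abs_of_nonneg (sq_nonneg _)]; exact hf.sq_le' x

theorem integrable_sq_add (h : IsPotential Φ) (hf : BddDeriv f f' M) :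
    Integrable (fun x => (f x ^ 2 + f' x ^ 2) * Real.exp (-Φ |x|)) := by
  simp only [add_mul]
  exact (h.integrable_sq hf).add (h.integrable_sq' hf)

theorem integrable_min (h : IsPotential Φ) (hf : BddDeriv f f' M) {a : ℝ} (ha : 0 ≤ a) :
    Integrable (fun x => f x ^ 2 * min 1 (a * Φ |x|) * Real.exp (-Φ |x|)) := by
  have hc : Continuous fun x : ℝ => Φ |x| :=
    h.continuousOn.comp_continuous continuous_abs fun x => abs_nonneg x
  refine h.integrable_mul (B := M ^ 2)
    ((hf.cont.pow 2).mul (continuous_const.min (continuous_const.mul hc))) fun x => ?_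
  have h0 : 0 ≤ min 1 (a * Φ |x|) := le_min zero_le_one (mul_nonneg ha (h.nonneg (abs_nonneg x)))
  rw [abs_of_nonneg (mul_nonneg (sq_nonneg _) h0)]
  exact (mul_le_of_le_one_right (sq_nonneg _) (min_le_left _ _)).trans (hf.sq_le x)

/-- Integrate the derivative of (1 - x) f² over [0,1], where the density is at least exp(-Φ(1)). -/
theorem apply_zero_sq_le (h : IsPotential Φ) (hf : BddDeriv f f' M) :
    f 0 ^ 2 ≤ 2 * Real.exp (Φ 1) * ∫ x in Ioi 0, (f x ^ 2 + f' x ^ 2) * Real.exp (-Φ |x|) := by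
  have hI := (h.integrable_sq_add hf).const_mul (2 * Real.exp (Φ 1))
  have h1 := intervalIntegral.sub_le_integral_of_hasDeriv_right_of_le
    (g := fun x => -((1 - x) * f x ^ 2))
    (g' := fun x => -(-1 * f x ^ 2 + (1 - x) * (2 * f x * f' x)))
    (φ := fun x => 2 * Real.exp (Φ 1) * ((f x ^ 2 + f' x ^ 2) * Real.exp (-Φ |x|)))
    (zero_le_one' ℝ) ?_ ?_ hI.integrableOn ?_
  · rw [← integral_const_mul]
    have h2 : ∫ x in (0 : ℝ)..1, 2 * Real.exp (Φ 1) * ((f x ^ 2 + f' x ^ 2) * Real.exp (-Φ |x|)) ≤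
        ∫ x in Ioi 0, 2 * Real.exp (Φ 1) * ((f x ^ 2 + f' x ^ 2) * Real.exp (-Φ |x|)) := by
      rw [intervalIntegral.integral_of_le zero_le_one]
      exact setIntegral_mono_set hI.integrableOn (ae_of_all _ fun x => by positivity)
        Ioc_subset_Ioi_self.eventuallyLE
    refine le_trans (le_of_eq ?_) (h1.trans h2)
    norm_num
  · have := hf.cont
    fun_prop
  · intro x _
    refine HasDerivAt.hasDerivWithinAt ?_
    have h3 := (((hasDerivAt_id x).const_sub 1).mul ((hf.hasDerivAt x).pow 2)).neg
    refine h3.congr_deriv ?_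
    simp
  · intro x hx
    have hΦ : Φ |x| ≤ Φ 1 := by
      rw [abs_of_pos hx.1, h.le_iff_le hx.1.le zero_le_one]; exact hx.2.le
    have he : 1 ≤ Real.exp (Φ 1) * Real.exp (-Φ |x|) := by
      rw [← Real.exp_add]; exact Real.one_le_exp (by linarith)
    have hs : 0 ≤ f x ^ 2 + f' x ^ 2 := by positivity
    have h4 : 2 * (f x ^ 2 + f' x ^ 2) ≤
        2 * Real.exp (Φ 1) * ((f x ^ 2 + f' x ^ 2) * Real.exp (-Φ |x|)) := by nlinarith
    refine le_trans ?_ h4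
    nlinarith [sq_nonneg (f x + (1 - x) * f' x), sq_nonneg (f' x), hx.1, hx.2,
      mul_nonneg (sq_nonneg (f' x)) (mul_nonneg hx.1.le (by linarith [hx.2] : 0 ≤ 2 - x))]

theorem hasDerivAt_exp (h : IsPotential Φ) {x : ℝ} (hx : 0 < x) :
    HasDerivAt (fun x => Real.exp (-Φ |x|)) (-(deriv Φ x * Real.exp (-Φ |x|))) x := by
  have h1 : HasDerivAt (fun x => Real.exp (-Φ x)) (Real.exp (-Φ x) * -deriv Φ x) x :=
    (h.hasDerivAt hx).neg.exp
  have h2 : (fun x => Real.exp (-Φ |x|)) =ᶠ[𝓝 x] fun x => Real.exp (-Φ x) := by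
    filter_upwards [lt_mem_nhds hx] with y hy
    rw [abs_of_pos hy]
  refine (h1.congr_of_eventuallyEq h2).congr_deriv ?_
  rw [abs_of_pos hx]; ring

/-- The derivative of f² exp(-Φ) is at most (f² + f'²) exp(-Φ), the term in Φ' having the good sign;
the value at 0 is controlled by the previous bound. -/
theorem apply_sq_le (h : IsPotential Φ) (hf : BddDeriv f f' M) {x : ℝ} (hx : 0 ≤ x) :
    f x ^ 2 * Real.exp (-Φ |x|) ≤
      (2 * Real.exp (Φ 1) + 1) * ∫ x in Ioi 0, (f x ^ 2 + f' x ^ 2) * Real.exp (-Φ |x|) := by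
  have hI := h.integrable_sq_add hf
  have h1 := intervalIntegral.sub_le_integral_of_hasDeriv_right_of_le
    (g := fun x => f x ^ 2 * Real.exp (-Φ |x|))
    (g' := fun x => (2 * f x * f' x) * Real.exp (-Φ |x|) +
      f x ^ 2 * (-(deriv Φ x * Real.exp (-Φ |x|))))
    (φ := fun x => (f x ^ 2 + f' x ^ 2) * Real.exp (-Φ |x|))
    hx ((hf.cont.pow 2).mul h.continuous_exp).continuousOn ?_ hI.integrableOn ?_
  · have h2 : ∫ y in (0 : ℝ)..x, (f y ^ 2 + f' y ^ 2) * Real.exp (-Φ |y|) ≤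
        ∫ y in Ioi 0, (f y ^ 2 + f' y ^ 2) * Real.exp (-Φ |y|) := by
      rw [intervalIntegral.integral_of_le hx]
      exact setIntegral_mono_set hI.integrableOn (ae_of_all _ fun x => by positivity)
        Ioc_subset_Ioi_self.eventuallyLE
    have h3 := h.apply_zero_sq_le hf
    simp only [abs_zero, h.zero, neg_zero, Real.exp_zero, mul_one] at h1
    linarith
  · intro y hy
    refine HasDerivAt.hasDerivWithinAt ?_
    refine (((hf.hasDerivAt y).pow 2).mul (h.hasDerivAt_exp hy.1)).congr_deriv ?_
    simp
  · intro y hy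
    have h5 : 0 ≤ f y ^ 2 * (deriv Φ y * Real.exp (-Φ |y|)) :=
      mul_nonneg (sq_nonneg _) (mul_nonneg (h.deriv_pos hy.1).le (Real.exp_pos _).le)
    have h6 : 0 ≤ (f y - f' y) ^ 2 * Real.exp (-Φ |y|) := by positivity
    nlinarith

/-- The tail `∫_x^∞ exp (-Φ(|t|)) dt` is at most a multiple of `exp (-Φ(|x|))`. -/
theorem tail_le (h : IsPotential Φ) {x : ℝ} (hx : 0 ≤ x) :
    ∫ t in Ioi x, Real.exp (-Φ |t|) ≤
      (∫ t in Ioi 0, Real.exp (-Φ |t|)) * Real.exp (-Φ |x|) := by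
  have h1 : ∫ t in Ioi x, Real.exp (-Φ |t|) = ∫ t in Ioi 0, Real.exp (-Φ |t + x|) := by
    have := (measurePreserving_add_right (volume : Measure ℝ) x).setIntegral_preimage_emb
      (measurableEmbedding_addRight x) (fun t => Real.exp (-Φ |t|)) (Ioi x)
    rw [← this]
    simp
  rw [h1, ← integral_mul_const]
  refine setIntegral_mono_on ?_ (h.integrableOn_exp.mul_const _) measurableSet_Ioi fun t ht => ?_
  · exact ((h.integrable_exp).comp_add_right x).integrableOn
  · have ht' : 0 < t := ht
    rw [← Real.exp_add, Real.exp_le_exp, abs_of_nonneg (by linarith), abs_of_pos ht',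
      abs_of_nonneg hx]
    -- Superadditivity of Φ: Φ(t) + Φ(x) ≤ Φ(t + x).
    linarith [h.add_le ht'.le hx]

/-- Differentiate f² times the tail s of the density. The term f² s' is minus the target integrand,
and 2 f f' s is absorbed because s ≤ S exp(-Φ). The boundary term vanishes as f(0) = 0. -/
theorem poincare_half (h : IsPotential Φ) (hf : BddDeriv f f' M) (h0 : f 0 = 0) :
    ∫ x in Ioi 0, f x ^ 2 * Real.exp (-Φ |x|) ≤
      4 * (∫ t in Ioi 0, Real.exp (-Φ |t|)) ^ 2 *
        ∫ x in Ioi 0, f' x ^ 2 * Real.exp (-Φ |x|) := by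
  set S := ∫ t in Ioi 0, Real.exp (-Φ |t|) with hS
  have hS0 : 0 ≤ S := integral_nonneg fun x => (Real.exp_pos _).le
  have hs : ∀ x, S - (∫ t in (0 : ℝ)..x, Real.exp (-Φ |t|)) = ∫ t in Ioi x, Real.exp (-Φ |t|) := by
    intro x
    rw [hS, ← intervalIntegral.integral_Ioi_sub_Ioi' h.integrableOn_exp
      h.integrable_exp.integrableOn]
    ring
  have hd : ∀ x, HasDerivAt (fun x => S - (∫ t in (0 : ℝ)..x, Real.exp (-Φ |t|)))
      (-Real.exp (-Φ |x|)) x := fun x =>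
    (h.continuous_exp.integral_hasStrictDerivAt 0 x).hasDerivAt.const_sub S
  have hI := h.integrable_sq hf
  have hI' := h.integrable_sq' hf
  have h1 := neg_le_integral_Ioi_of_hasDeriv_right_le (a := 0)
    (H := fun x => f x ^ 2 * (S - ∫ t in (0 : ℝ)..x, Real.exp (-Φ |t|)))
    (H' := fun x => (2 * f x * f' x) * (S - ∫ t in (0 : ℝ)..x, Real.exp (-Φ |t|)) +
      f x ^ 2 * (-Real.exp (-Φ |x|)))
    (φ := fun x => (2 * S ^ 2) * (f' x ^ 2 * Real.exp (-Φ |x|)) -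
      1 / 2 * (f x ^ 2 * Real.exp (-Φ |x|))) ?_ ?_ ?_ ?_ ?_
  · rw [integral_sub (hI'.const_mul _).integrableOn (hI.const_mul _).integrableOn,
      integral_const_mul, integral_const_mul] at h1
    simp only [h0] at h1
    linarith
  · exact (((hf.cont.pow 2).mul (continuous_iff_continuousAt.2 fun x =>
      (hd x).continuousAt)).continuousOn)
  · intro x _
    refine HasDerivAt.hasDerivWithinAt ?_
    refine (((hf.hasDerivAt x).pow 2).mul (hd x)).congr_deriv ?_
    simp
  · intro x hx
    have ht := h.tail_le hx.le
    have ht0 : 0 ≤ ∫ t in Ioi x, Real.exp (-Φ |t|) := integral_nonneg fun x => (Real.exp_pos _).le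
    simp only [hs]
    set s := ∫ t in Ioi x, Real.exp (-Φ |t|)
    set v := Real.exp (-Φ |x|)
    have hv : 0 < v := Real.exp_pos _
    have h2 : f x * f' x * s ≤ |f x| * |f' x| * (S * v) := by
      calc f x * f' x * s ≤ |f x * f' x| * s := by gcongr; exact le_abs_self _
        _ ≤ |f x| * |f' x| * (S * v) := by rw [abs_mul]; gcongr
    have h3 : 0 ≤ (|f x| - 2 * S * |f' x|) ^ 2 * v := by positivity
    rw [← sq_abs (f x), ← sq_abs (f' x)]
    nlinarith
  · exact (hI'.const_mul _).integrableOn.sub (hI.const_mul _).integrableOn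
  · intro x _
    simp only [hs]
    exact mul_nonneg (sq_nonneg _) (integral_nonneg fun x => (Real.exp_pos _).le)

end IsPotential

/-! ### The weighted Hardy inequality -/

namespace IsPotential

variable {Φ : ℝ → ℝ} {f f' : ℝ → ℝ} {M : ℝ}

theorem le_inv_iff (h : IsPotential Φ) {x y : ℝ} (hx : 0 ≤ x) (hy : 0 ≤ y) :
    x ≤ potentialInv Φ y ↔ Φ x ≤ y := by
  rw [← h.le_iff_le hx (h.inv_nonneg hy), h.apply_inv hy]

theorem inv_le_iff (h : IsPotential Φ) {x y : ℝ} (hx : 0 ≤ x) (hy : 0 ≤ y) :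
    potentialInv Φ y ≤ x ↔ y ≤ Φ x := by
  rw [← h.le_iff_le (h.inv_nonneg hy) hx, h.apply_inv hy]

/-- Compare Φ'/√Φ at x and at Φ⁻¹(1/a), which lies to the right of x. -/
theorem deriv_inv_mul_sqrt_le (h : IsPotential Φ) {a : ℝ} (ha : 0 < a) {x : ℝ} (hx : 0 < x)
    (hxa : a * Φ x ≤ 1) :
    deriv Φ (potentialInv Φ (1 / a)) * Real.sqrt a * Real.sqrt (Φ x) ≤ deriv Φ x := by
  have ha' : 0 < 1 / a := by positivity
  have hR := h.inv_pos ha'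
  have hxR : x ≤ potentialInv Φ (1 / a) := by
    rw [h.le_inv_iff hx.le ha'.le, le_div_iff₀ ha]; linarith
  have := h.antitoneOn_deriv_div_sqrt (mem_Ioi.2 hx) (mem_Ioi.2 hR) hxR
  simp only [h.apply_inv ha'.le] at this
  have hs := Real.sqrt_pos.2 (h.pos hx)
  rw [one_div, Real.sqrt_inv, div_inv_eq_mul, le_div_iff₀ hs] at this
  simpa only [one_div] using this

/-- The previous bound at x = Φ⁻¹(1); it says that T(a) is at least a constant multiple of a. -/
theorem deriv_inv_sq_mul_le (h : IsPotential Φ) {a : ℝ} (ha : 0 < a) (ha1 : a ≤ 1) :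
    deriv Φ (potentialInv Φ (1 / a)) ^ 2 * a ≤ deriv Φ (potentialInv Φ 1) ^ 2 := by
  have hp := h.inv_pos one_pos
  have h1 := h.deriv_inv_mul_sqrt_le ha hp (by rwa [h.apply_inv zero_le_one, mul_one])
  rw [h.apply_inv zero_le_one, Real.sqrt_one, mul_one] at h1
  have h2 : 0 ≤ deriv Φ (potentialInv Φ (1 / a)) * Real.sqrt a :=
    mul_nonneg (h.deriv_pos (h.inv_pos (by positivity))).le (Real.sqrt_nonneg _)
  calc deriv Φ (potentialInv Φ (1 / a)) ^ 2 * a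
      = (deriv Φ (potentialInv Φ (1 / a)) * Real.sqrt a) ^ 2 := by
        rw [mul_pow, Real.sq_sqrt ha.le]
    _ ≤ _ := pow_le_pow_left₀ h2 h1 2

/-- The multiplier D √min(1, aΦ) is dominated by Φ', so the decay of exp(-Φ) pays for its square.
Starting at Φ⁻¹(1), where Φ ≥ 1, also keeps the derivative of the multiplier under control. -/
theorem weight_half_tail (h : IsPotential Φ) (hf : BddDeriv f f' M) {a : ℝ} (ha : 0 < a)
    (ha1 : a ≤ 1) :
    deriv Φ (potentialInv Φ (1 / a)) ^ 2 *
        ∫ x in Ioi (potentialInv Φ 1), f x ^ 2 * min 1 (a * Φ |x|) * Real.exp (-Φ |x|) ≤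
      4 * deriv Φ (potentialInv Φ 1) *
          (f (potentialInv Φ 1) ^ 2 * Real.exp (-Φ |potentialInv Φ 1|)) +
        16 * ∫ x in Ioi (potentialInv Φ 1), f' x ^ 2 * Real.exp (-Φ |x|) := by
  have ha' : 0 < 1 / a := by positivity
  have hb := h.inv_pos one_pos
  have hR := h.inv_pos ha'
  have hΦb := h.apply_inv zero_le_one
  have hκ := h.deriv_inv_sq_mul_le ha ha1
  have hD := h.deriv_pos hR
  have hlow : ∀ x, 0 < x → a * Φ x ≤ 1 →
      deriv Φ (potentialInv Φ (1 / a)) * Real.sqrt a * Real.sqrt (Φ x) ≤ deriv Φ x :=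
    fun x hx => h.deriv_inv_mul_sqrt_le ha hx
  have hhigh : ∀ x, 0 < x → 1 ≤ a * Φ x → deriv Φ (potentialInv Φ (1 / a)) ≤ deriv Φ x := by
    intro x hx hax
    refine h.monotoneOn_deriv (mem_Ioi.2 hR) (mem_Ioi.2 hx) ?_
    rw [h.inv_le_iff hx.le ha'.le, div_le_iff₀ ha]; linarith
  set b := potentialInv Φ 1
  set D := deriv Φ (potentialInv Φ (1 / a))
  have hI := h.integrable_min hf ha.le
  have hI' := h.integrable_sq' hf
  have hΦc : Continuous fun x : ℝ => Φ |x| :=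
    h.continuousOn.comp_continuous continuous_abs fun x => abs_nonneg x
  -- The minimum has a kink where aΦ = 1, hence right derivatives; there, and beyond, the multiplier
  -- is constant to the right.
  have h1 := neg_le_integral_Ioi_of_hasDeriv_right_le (a := b)
    (H := fun x => f x ^ 2 * (D * Real.sqrt (min 1 (a * Φ |x|))) * Real.exp (-Φ |x|))
    (H' := fun x => if a * Φ x < 1 then
      (2 * f x * f' x * (D * Real.sqrt (a * Φ |x|)) +
        f x ^ 2 * (D * (a * deriv Φ x / (2 * Real.sqrt (a * Φ x))))) * Real.exp (-Φ |x|) +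
      f x ^ 2 * (D * Real.sqrt (a * Φ |x|)) * (-(deriv Φ x * Real.exp (-Φ |x|)))
      else (2 * f x * f' x * D) * Real.exp (-Φ |x|) +
        f x ^ 2 * D * (-(deriv Φ x * Real.exp (-Φ |x|))))
    (φ := fun x => 4 * (f' x ^ 2 * Real.exp (-Φ |x|)) -
      D ^ 2 / 4 * (f x ^ 2 * min 1 (a * Φ |x|) * Real.exp (-Φ |x|))) ?_ ?_ ?_ ?_ ?_
  · rw [integral_sub (hI'.const_mul _).integrableOn (hI.const_mul _).integrableOn,
      integral_const_mul, integral_const_mul] at h1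
    -- The boundary term is uniform in a because D √a ≤ Φ'(b).
    have h2 : D * Real.sqrt (min 1 (a * Φ |b|)) ≤ deriv Φ b := by
      have h3 := hlow b hb (by rw [hΦb]; linarith)
      rw [hΦb, Real.sqrt_one, mul_one] at h3
      rwa [abs_of_pos hb, hΦb, mul_one, min_eq_right ha1]
    have h4 : f b ^ 2 * (D * Real.sqrt (min 1 (a * Φ |b|))) * Real.exp (-Φ |b|) ≤
        deriv Φ b * (f b ^ 2 * Real.exp (-Φ |b|)) := by
      have : 0 ≤ f b ^ 2 * Real.exp (-Φ |b|) := by positivity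
      nlinarith
    linarith
  · exact (((hf.cont.pow 2).mul (continuous_const.mul
      (continuous_const.min (continuous_const.mul hΦc)).sqrt)).mul h.continuous_exp).continuousOn
  · intro x hx
    have hx0 : 0 < x := hb.trans hx
    have hp := h.pos hx0
    have he := h.hasDerivAt_exp hx0
    have hf2 : HasDerivAt (fun x => f x ^ 2) (2 * f x * f' x) x :=
      ((hf.hasDerivAt x).pow 2).congr_deriv (by simp)
    split_ifs with hlt
    · refine HasDerivAt.hasDerivWithinAt ?_
      have hev : (fun x => f x ^ 2 * (D * Real.sqrt (min 1 (a * Φ |x|))) * Real.exp (-Φ |x|))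
          =ᶠ[𝓝 x] fun x => f x ^ 2 * (D * Real.sqrt (a * Φ x)) * Real.exp (-Φ |x|) := by
        have hlt' : a * Φ |x| < 1 := by rwa [abs_of_pos hx0]
        filter_upwards [lt_mem_nhds hx0,
          (continuous_const.mul hΦc).continuousAt.eventually_lt continuousAt_const hlt'] with y hy hy1
        have hy2 : a * Φ |y| < 1 := hy1
        rw [min_eq_right hy2.le, abs_of_pos hy]
      refine HasDerivAt.congr_of_eventuallyEq ?_ hev
      have hs := (((h.hasDerivAt hx0).const_mul a).sqrt (mul_pos ha hp).ne').const_mul D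
      have := (hf2.mul hs).mul he
      simp only [abs_of_pos hx0] at this ⊢
      exact this
    · have h5 := ((hf2.mul_const D).mul he).hasDerivWithinAt (s := Ioi x)
      have hone : ∀ y, x ≤ y → min 1 (a * Φ |y|) = 1 := by
        intro y hy
        refine min_eq_left ?_
        rw [abs_of_nonneg (hx0.le.trans hy)]
        have := (h.le_iff_le hx0.le (hx0.le.trans hy)).2 hy
        push Not at hlt
        exact hlt.trans (mul_le_mul_of_nonneg_left this ha.le)
      refine h5.congr (fun y hy => ?_) ?_
      · simp [hone y (le_of_lt hy)]
      · simp [hone x le_rfl]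
  · intro x hx
    have hx0 : 0 < x := hb.trans hx
    have hp := h.pos hx0
    have hv : 0 < Real.exp (-Φ |x|) := Real.exp_pos _
    have hdx := h.deriv_pos hx0
    simp only [abs_of_pos hx0] at hv ⊢
    generalize hvv : Real.exp (-Φ x) = v at hv ⊢
    -- With A the multiplier, the decay leaves at least f² A²/2; half of it absorbs this cross term
    -- and f² A²/4 survives.
    have hcs : ∀ A : ℝ, 2 * f x * f' x * A ≤ 4 * f' x ^ 2 + f x ^ 2 * A ^ 2 / 4 := by
      intro A; nlinarith [sq_nonneg (f x * A / 2 - 2 * f' x)]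
    split_ifs with hlt
    · rw [min_eq_right hlt.le]
      have hl := hlow x hx0 hlt.le
      have hΦ1 : 1 ≤ Φ x := by
        rw [← h.inv_le_iff hx0.le zero_le_one]; exact hx.le
      set t := Real.sqrt (a * Φ x) with ht
      have ht0 : 0 < t := Real.sqrt_pos.2 (mul_pos ha hp)
      have htt : t ^ 2 = a * Φ x := Real.sq_sqrt (mul_pos ha hp).le
      have hl' : D * t ≤ deriv Φ x := by
        rw [ht, Real.sqrt_mul ha.le]; linarith
      -- Since Φ ≥ 1, a ≤ t², so differentiating the multiplier costs at most half of the decay.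
      have e : a * deriv Φ x / (2 * t) ≤ t * deriv Φ x / 2 := by
        rw [div_le_iff₀ (by positivity)]
        have : a ≤ t ^ 2 := by rw [htt]; nlinarith
        nlinarith
      have h6 := hcs (D * t)
      rw [← htt]
      have h7 : f x ^ 2 * (D * (a * deriv Φ x / (2 * t))) ≤
          f x ^ 2 * (D * (t * deriv Φ x / 2)) := by gcongr
      have h8 : f x ^ 2 * (D * t * (D * t)) ≤ f x ^ 2 * (D * t * deriv Φ x) := by gcongr
      have key : 2 * f x * f' x * (D * t) + f x ^ 2 * (D * (a * deriv Φ x / (2 * t))) -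
          f x ^ 2 * (D * t) * deriv Φ x ≤ 4 * f' x ^ 2 - D ^ 2 / 4 * (f x ^ 2 * t ^ 2) := by
        nlinarith
      have := mul_le_mul_of_nonneg_right key hv.le
      linarith
    · push Not at hlt
      rw [min_eq_left hlt]
      have hl := hhigh x hx0 hlt
      have h6 := hcs D
      have h8 : f x ^ 2 * (D * D) ≤ f x ^ 2 * (D * deriv Φ x) := by gcongr
      have h9 : 0 ≤ f x ^ 2 * (D * D) := by positivity
      have key : 2 * f x * f' x * D - f x ^ 2 * D * deriv Φ x ≤
          4 * f' x ^ 2 - D ^ 2 / 4 * (f x ^ 2 * 1) := by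
        nlinarith
      have := mul_le_mul_of_nonneg_right key hv.le
      linarith
  · exact (hI'.const_mul _).integrableOn.sub (hI.const_mul _).integrableOn
  · intro x _
    positivity

/-- A weighted Hardy inequality on the half-line, with weight `min 1 (a Φ)`. -/
theorem weight_half (h : IsPotential Φ) (hf : BddDeriv f f' M) {a : ℝ} (ha : 0 < a)
    (ha1 : a ≤ 1) :
    deriv Φ (potentialInv Φ (1 / a)) ^ 2 *
        ∫ x in Ioi 0, f x ^ 2 * min 1 (a * Φ |x|) * Real.exp (-Φ |x|) ≤
      (4 * deriv Φ (potentialInv Φ 1) * (2 * Real.exp (Φ 1) + 1) + 16 +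
        deriv Φ (potentialInv Φ 1) ^ 2) *
        ∫ x in Ioi 0, (f x ^ 2 + f' x ^ 2) * Real.exp (-Φ |x|) := by
  have hb := h.inv_pos one_pos
  have h1 := h.weight_half_tail hf ha ha1
  have h2 := h.apply_sq_le hf hb.le
  have h3 := h.deriv_inv_sq_mul_le ha ha1
  have h4 := h.deriv_pos hb
  have hI := h.integrable_min hf ha.le
  have hI' := h.integrable_sq' hf
  have hJ := h.integrable_sq_add hf
  have hbΦ := h.apply_inv zero_le_one
  set b := potentialInv Φ 1
  set D := deriv Φ (potentialInv Φ (1 / a))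
  have h5 : ∫ x in Ioi b, f' x ^ 2 * Real.exp (-Φ |x|) ≤
      ∫ x in Ioi 0, (f x ^ 2 + f' x ^ 2) * Real.exp (-Φ |x|) := by
    refine (setIntegral_mono hI'.integrableOn hJ.integrableOn fun x => ?_).trans
      (setIntegral_mono_set hJ.integrableOn (ae_of_all _ fun x => by positivity)
        (Ioi_subset_Ioi hb.le).eventuallyLE)
    have : 0 ≤ f x ^ 2 := sq_nonneg _
    dsimp only
    gcongr
    linarith
  -- On (0, b] the weight is at most a, and D² a is bounded by Φ'(b)².
  have h6 : D ^ 2 * ∫ x in Ioc 0 b, f x ^ 2 * min 1 (a * Φ |x|) * Real.exp (-Φ |x|) ≤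
      deriv Φ b ^ 2 * ∫ x in Ioi 0, (f x ^ 2 + f' x ^ 2) * Real.exp (-Φ |x|) := by
    rw [← integral_const_mul, ← integral_const_mul]
    refine (setIntegral_mono_on (hI.const_mul _).integrableOn (hJ.const_mul _).integrableOn
      measurableSet_Ioc fun x hx => ?_).trans
      (setIntegral_mono_set (hJ.const_mul _).integrableOn (ae_of_all _ fun x => by positivity)
        Ioc_subset_Ioi_self.eventuallyLE)
    have hΦ1 : Φ |x| ≤ 1 := by
      rw [abs_of_pos hx.1, ← h.le_inv_iff hx.1.le zero_le_one]; exact hx.2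
    have hm : D ^ 2 * min 1 (a * Φ |x|) ≤ deriv Φ b ^ 2 := by
      refine le_trans ?_ h3
      gcongr
      exact (min_le_right _ _).trans (by nlinarith)
    calc D ^ 2 * (f x ^ 2 * min 1 (a * Φ |x|) * Real.exp (-Φ |x|))
        = (D ^ 2 * min 1 (a * Φ |x|)) * (f x ^ 2 * Real.exp (-Φ |x|)) := by ring
      _ ≤ deriv Φ b ^ 2 * (f x ^ 2 * Real.exp (-Φ |x|)) := by gcongr
      _ ≤ _ := by
        gcongr
        nlinarith [sq_nonneg (f' x)]
  have h7 : ∫ x in Ioi 0, f x ^ 2 * min 1 (a * Φ |x|) * Real.exp (-Φ |x|) =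
      (∫ x in Ioc 0 b, f x ^ 2 * min 1 (a * Φ |x|) * Real.exp (-Φ |x|)) +
      ∫ x in Ioi b, f x ^ 2 * min 1 (a * Φ |x|) * Real.exp (-Φ |x|) := by
    rw [← setIntegral_union Ioc_disjoint_Ioi_same measurableSet_Ioi hI.integrableOn
      hI.integrableOn, Ioc_union_Ioi_eq_Ioi hb.le]
  rw [h7, mul_add]
  have h8 := mul_le_mul_of_nonneg_left h2 (by positivity : 0 ≤ 4 * deriv Φ b)
  linarith

end IsPotential

/-! ### From the half-line to the line -/

namespace IsPotential

variable {Φ : ℝ → ℝ} {f f' : ℝ → ℝ} {M : ℝ}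

theorem integral_eq_half_add (h : IsPotential Φ) {F : ℝ → ℝ}
    (hF : Integrable fun x => F x * Real.exp (-Φ |x|)) :
    ∫ x, F x ∂potentialMeasure Φ = (partitionConst Φ)⁻¹ *
      ((∫ x in Ioi 0, F x * Real.exp (-Φ |x|)) + ∫ x in Ioi 0, F (-x) * Real.exp (-Φ |x|)) := by
  have h1 := integral_comp_neg_Ioi 0 fun x => F x * Real.exp (-Φ |x|)
  simp only [abs_neg, neg_zero] at h1
  rw [h.integral_eq, h1, ← intervalIntegral.integral_Iic_add_Ioi (b := 0) hF.integrableOn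
    hF.integrableOn]
  ring

theorem integral_sq_add_half_le (h : IsPotential Φ) (hf : BddDeriv f f' M) :
    ∫ x in Ioi 0, (f x ^ 2 + f' x ^ 2) * Real.exp (-Φ |x|) ≤
      partitionConst Φ * ∫ x, (f x ^ 2 + f' x ^ 2) ∂potentialMeasure Φ := by
  rw [h.integral_eq, ← mul_assoc, mul_inv_cancel₀ h.partitionConst_pos.ne', one_mul]
  exact setIntegral_le_integral (h.integrable_sq_add hf) (ae_of_all _ fun x => by positivity)

/-- Reflection transfers the half-line bound to negative x. Its logarithm is what later replaces
log(f/m) by Φ. -/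
theorem apply_sq_le_exp (h : IsPotential Φ) (hf : BddDeriv f f' M) (x : ℝ) :
    f x ^ 2 ≤ (2 * Real.exp (Φ 1) + 1) * partitionConst Φ *
      (∫ x, (f x ^ 2 + f' x ^ 2) ∂potentialMeasure Φ) * Real.exp (Φ |x|) := by
  have key : ∀ {g g' : ℝ → ℝ}, BddDeriv g g' M → ∀ {y : ℝ}, 0 ≤ y →
      g y ^ 2 ≤ (2 * Real.exp (Φ 1) + 1) * (∫ x in Ioi 0, (g x ^ 2 + g' x ^ 2) *
        Real.exp (-Φ |x|)) * Real.exp (Φ |y|) := by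
    intro g g' hg y hy
    have h1 := mul_le_mul_of_nonneg_right (h.apply_sq_le hg hy) (Real.exp_pos (Φ |y|)).le
    rwa [mul_assoc, ← Real.exp_add, neg_add_cancel, Real.exp_zero, mul_one] at h1
  rcases le_total 0 x with hx | hx
  · refine (key hf hx).trans ?_
    rw [mul_assoc _ (partitionConst Φ)]
    gcongr
    exact h.integral_sq_add_half_le hf
  · have h1 := key hf.comp_neg (neg_nonneg.2 hx)
    simp only [neg_neg, abs_neg] at h1
    refine h1.trans ?_
    rw [mul_assoc _ (partitionConst Φ)]
    gcongr
    refine (h.integral_sq_add_half_le hf.comp_neg).trans_eq ?_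
    rw [h.integral_eq, h.integral_eq]
    congr 2
    have := integral_neg_eq_self (fun x => (f x ^ 2 + f' x ^ 2) * Real.exp (-Φ |x|)) volume
    simpa using this

/-- Centring at f(0) decouples the half-lines, and it suffices for the variance, which is at most
the second moment about any point. -/
theorem poincare_at_zero (h : IsPotential Φ) (hf : BddDeriv f f' M) :
    ∫ x, (f x - f 0) ^ 2 ∂potentialMeasure Φ ≤
      4 * (∫ t in Ioi 0, Real.exp (-Φ |t|)) ^ 2 * ∫ x, f' x ^ 2 ∂potentialMeasure Φ := by
  have hg := hf.sub_const (f 0)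
  have h1 := h.poincare_half hg (sub_self _)
  have h2 := h.poincare_half hg.comp_neg (by simp)
  rw [h.integral_eq_half_add (h.integrable_sq hg), h.integral_eq_half_add (h.integrable_sq' hf),
    mul_left_comm]
  refine mul_le_mul_of_nonneg_left ?_ (_root_.inv_pos.2 h.partitionConst_pos).le
  rw [mul_add]
  simpa using add_le_add h1 h2

theorem weighted (h : IsPotential Φ) (hf : BddDeriv f f' M) {a : ℝ} (ha : 0 < a) (ha1 : a ≤ 1) :
    ∫ x, f x ^ 2 * min 1 (a * Φ |x|) ∂potentialMeasure Φ ≤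
      (4 * deriv Φ (potentialInv Φ 1) * (2 * Real.exp (Φ 1) + 1) + 16 +
        deriv Φ (potentialInv Φ 1) ^ 2) * becknerRate Φ a *
        ∫ x, (f x ^ 2 + f' x ^ 2) ∂potentialMeasure Φ := by
  have h1 := h.weight_half hf ha ha1
  have h2 := h.weight_half hf.comp_neg ha ha1
  have hD := h.deriv_pos (h.inv_pos (one_div_pos.2 ha))
  rw [h.integral_eq_half_add (h.integrable_min hf ha.le),
    h.integral_eq_half_add (h.integrable_sq_add hf), mul_left_comm, becknerRate, div_pow, one_pow]
  refine mul_le_mul_of_nonneg_left ?_ (_root_.inv_pos.2 h.partitionConst_pos).le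
  rw [mul_one_div, div_mul_eq_mul_div, le_div_iff₀ (by positivity), mul_comm, mul_add, mul_add]
  simpa using add_le_add h1 h2

/-- Converts a factor 2 - p into T(2 - p). -/
theorem le_becknerRate (h : IsPotential Φ) {a : ℝ} (ha : 0 < a) (ha1 : a ≤ 1) :
    a ≤ deriv Φ (potentialInv Φ 1) ^ 2 * becknerRate Φ a := by
  have hD := h.deriv_pos (h.inv_pos (one_div_pos.2 ha))
  have := h.deriv_inv_sq_mul_le ha ha1
  rw [becknerRate, div_pow, one_pow, mul_one_div, le_div_iff₀ (by positivity)]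
  linarith

theorem becknerRate_pos (h : IsPotential Φ) {a : ℝ} (ha : 0 < a) : 0 < becknerRate Φ a := by
  have hD := h.deriv_pos (h.inv_pos (one_div_pos.2 ha))
  rw [becknerRate]
  positivity

end IsPotential

/-! ### The Beckner inequality on the line -/

/-- The second order remainder of `x ↦ x ^ 2 - (2 / p) x ^ p` at `1`. -/
theorem sq_sub_rpow_le {p u : ℝ} (hp1 : 1 ≤ p) (hp2 : p ≤ 2) (hu : 0 < u) :
    u ^ 2 - 1 - 2 / p * (u ^ p - 1) ≤
      8 * (u - 1) ^ 2 * min 1 ((2 - p) * (1 + max (Real.log u) 0)) := by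
  have hp0 : 0 < p := by linarith
  rw [mul_min_of_nonneg _ _ (by positivity)]
  refine le_min ?_ ?_
  -- Bernoulli's inequality for u^p leaves exactly (u - 1)².
  · have h1 := one_add_mul_self_le_rpow_one_add (by linarith : -1 ≤ u - 1) hp1
    rw [add_sub_cancel] at h1
    have h2 : 2 * (u - 1) ≤ 2 / p * (u ^ p - 1) := by
      rw [div_mul_eq_mul_div, le_div_iff₀ hp0]; linarith
    nlinarith [sq_nonneg (u - 1)]
  -- Write u^p = u² exp(-(2 - p) log u) and use exp t ≥ 1 + t, which exhibits the factor 2 - p.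
  · have h1 : u ^ 2 * (1 - (2 - p) * Real.log u) ≤ u ^ p := by
      have e : u ^ p = u ^ 2 * Real.exp (-((2 - p) * Real.log u)) := by
        rw [← Real.rpow_natCast u 2, Real.rpow_def_of_pos hu, Real.rpow_def_of_pos hu,
          ← Real.exp_add]
        congr 1
        push_cast
        ring
      rw [e]
      have := Real.add_one_le_exp (-((2 - p) * Real.log u))
      gcongr
      linarith
    have h2 : 2 * u ^ 2 * Real.log u - u ^ 2 + 1 ≤
        8 * (u - 1) ^ 2 * (1 + max (Real.log u) 0) := by
      -- Up to 2, log u ≤ u - 1 suffices; from 2 on, u ≤ 2 (u - 1), which is where 8 comes from.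
      have hlog := Real.log_le_sub_one_of_pos hu
      rcases le_total u 2 with hu2 | hu2
      · have h3 : 8 * (u - 1) ^ 2 * 1 ≤ 8 * (u - 1) ^ 2 * (1 + max (Real.log u) 0) := by
          gcongr
          linarith [le_max_right (Real.log u) 0]
        refine le_trans ?_ h3
        have : 2 * u ^ 2 * Real.log u ≤ 2 * u ^ 2 * (u - 1) := by gcongr
        nlinarith [sq_nonneg (u - 1), mul_nonneg (sq_nonneg (u - 1)) (by linarith : 0 ≤ 2 - u)]
      · have hl0 : 0 ≤ Real.log u := Real.log_nonneg (by linarith)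
        rw [max_eq_left hl0]
        have h4 : 2 * u ^ 2 ≤ 8 * (u - 1) ^ 2 := by nlinarith
        nlinarith [mul_le_mul_of_nonneg_right h4 hl0, sq_nonneg (u - 1)]
    have h5 : u ^ 2 - 1 - 2 / p * (u ^ p - 1) ≤
        (2 - p) / p * (2 * u ^ 2 * Real.log u - u ^ 2 + 1) := by
      have e : (2 - p) / p * (2 * u ^ 2 * Real.log u - u ^ 2 + 1) =
          u ^ 2 - 1 - 2 / p * (u ^ 2 * (1 - (2 - p) * Real.log u) - 1) := by
        field_simp
        ring
      rw [e]
      gcongr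
    have h6 : 0 ≤ 8 * (u - 1) ^ 2 * (1 + max (Real.log u) 0) := by positivity
    calc _ ≤ (2 - p) / p * (2 * u ^ 2 * Real.log u - u ^ 2 + 1) := h5
      _ ≤ (2 - p) / p * (8 * (u - 1) ^ 2 * (1 + max (Real.log u) 0)) := by
        have : 0 ≤ (2 - p) / p := div_nonneg (by linarith) hp0.le
        gcongr
      _ ≤ (2 - p) * (8 * (u - 1) ^ 2 * (1 + max (Real.log u) 0)) := by
        refine mul_le_mul_of_nonneg_right ?_ h6
        exact div_le_self (by linarith) hp1
      _ = _ := by ring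

theorem sq_sub_rpow_le_of_pos {p m x : ℝ} (hp1 : 1 ≤ p) (hp2 : p ≤ 2) (hm : 0 < m) (hx : 0 < x) :
    x ^ 2 - m ^ 2 - 2 / p * (m ^ (2 - p) * x ^ p - m ^ 2) ≤
      8 * ((x - m) ^ 2 * min 1 ((2 - p) * (1 + max (Real.log (x / m)) 0))) := by
  have h1 := mul_le_mul_of_nonneg_left (sq_sub_rpow_le hp1 hp2 (div_pos hx hm)) (sq_nonneg m)
  have e : m ^ (2 - p) * x ^ p = m ^ 2 * (x / m) ^ p := by
    rw [Real.div_rpow hx.le hm.le, Real.rpow_sub hm, Real.rpow_two]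
    ring
  rw [e]
  have e2 : m ^ 2 * (x / m) ^ 2 = x ^ 2 := by field_simp
  have e3 : m ^ 2 * (x / m - 1) ^ 2 = (x - m) ^ 2 := by field_simp
  calc _ = m ^ 2 * (x / m) ^ 2 - m ^ 2 - 2 / p * (m ^ 2 * (x / m) ^ p - m ^ 2) := by rw [e2]
    _ = m ^ 2 * ((x / m) ^ 2 - 1 - 2 / p * ((x / m) ^ p - 1)) := by ring
    _ ≤ _ := h1
    _ = _ := by rw [← e3]; ring

theorem integrable_of_measurable_of_abs_le {X : Type*} [MeasurableSpace X]
    {μ : Measure X} [IsFiniteMeasure μ] {F : X → ℝ}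
    (hF : Measurable F) {B : ℝ} (hB : ∀ x, |F x| ≤ B) : Integrable F μ :=
  Integrable.of_bound hF.aestronglyMeasurable B (ae_of_all _ hB)

/-- A tangent line bound for `X ↦ X ^ (2 / p)`. -/
theorem sq_add_le_rpow {p m X : ℝ} (hp1 : 1 ≤ p) (hp2 : p ≤ 2) (hm : 0 < m) (hX : 0 ≤ X) :
    m ^ 2 + 2 / p * (m ^ (2 - p) * X - m ^ 2) ≤ X ^ (2 / p) := by
  have hp0 : 0 < p := by linarith
  have hmp : 0 < m ^ p := Real.rpow_pos_of_pos hm p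
  have h1 := one_add_mul_self_le_rpow_one_add (s := X / m ^ p - 1) (p := 2 / p)
    (by have : 0 ≤ X / m ^ p := by positivity
        linarith) ((one_le_div hp0).2 hp2)
  rw [add_sub_cancel, Real.div_rpow hX hmp.le, ← Real.rpow_mul hm.le, mul_div_cancel₀ _ hp0.ne',
    Real.rpow_two, le_div_iff₀ (by positivity)] at h1
  refine le_trans (le_of_eq ?_) h1
  rw [Real.rpow_sub hm, Real.rpow_two]
  field_simp

set_option maxHeartbeats 800000 in
/-- The one-dimensional Beckner inequality for positive bounded `C¹` functions. -/
theorem IsPotential.beckner_line {Φ : ℝ → ℝ} (h : IsPotential Φ) :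
    ∃ C : ℝ, 0 < C ∧ ∀ p ∈ Ioo (1 : ℝ) 2, ∀ (f f' : ℝ → ℝ) (M : ℝ), BddDeriv f f' M →
      (∀ x, 0 < f x) →
      ∫ x, f x ^ 2 ∂potentialMeasure Φ ≤ (∫ x, f x ^ p ∂potentialMeasure Φ) ^ (2 / p) +
        C * becknerRate Φ (2 - p) * ∫ x, f' x ^ 2 ∂potentialMeasure Φ := by
  have hprob := h.isProbabilityMeasure
  have hZ := h.partitionConst_pos
  set K : ℝ := 1 + (2 * Real.exp (Φ 1) + 1) * partitionConst Φ with hK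
  have hK1 : 1 ≤ K := by
    have : 0 ≤ (2 * Real.exp (Φ 1) + 1) * partitionConst Φ := by positivity
    linarith
  set P : ℝ := 4 * (∫ t in Ioi 0, Real.exp (-Φ |t|)) ^ 2 with hP
  have hP0 : 0 ≤ P := by positivity
  have hκ := h.deriv_pos (h.inv_pos one_pos)
  set κ : ℝ := deriv Φ (potentialInv Φ 1)
  set W : ℝ := 4 * κ * (2 * Real.exp (Φ 1) + 1) + 16 + κ ^ 2 with hW
  have hW0 : 0 < W := by positivity
  -- The κ² part pays for the constant part of the logarithm through Poincaré, the W part for Φ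
  -- through the weighted Hardy inequality applied to f - m.
  refine ⟨8 * (κ ^ 2 * ((1 + K) * (2 * P) + 2) + W * (2 * P + 1)), by positivity, ?_⟩
  rintro p ⟨hp1, hp2⟩ f f' M hf hpos
  set μ := potentialMeasure Φ
  have ha : 0 < 2 - p := by linarith
  have ha1 : 2 - p ≤ 1 := by linarith
  have hT := h.becknerRate_pos ha
  have haT : 2 - p ≤ κ ^ 2 * becknerRate Φ (2 - p) := h.le_becknerRate ha ha1
  set T := becknerRate Φ (2 - p)
  have hM0 : 0 ≤ M := (abs_nonneg _).trans (hf.bound 0)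
  have hΦc : Continuous fun x : ℝ => Φ |x| :=
    h.continuousOn.comp_continuous continuous_abs fun x => abs_nonneg x
  have hIf : Integrable f μ := integrable_of_measurable_of_abs_le hf.cont.measurable hf.bound
  have hIf2 : Integrable (fun x => f x ^ 2) μ :=
    integrable_of_measurable_of_abs_le (hf.cont.pow 2).measurable fun x => by
      rw [abs_of_nonneg (sq_nonneg _)]; exact hf.sq_le x
  have hIf'2 : Integrable (fun x => f' x ^ 2) μ :=
    integrable_of_measurable_of_abs_le (hf.cont'.pow 2).measurable fun x => by
      rw [abs_of_nonneg (sq_nonneg _)]; exact hf.sq_le' x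
  have hIfp : Integrable (fun x => f x ^ p) μ :=
    integrable_of_measurable_of_abs_le (B := M ^ p)
      (hf.cont.rpow_const fun x => Or.inl (hpos x).ne').measurable fun x => by
      rw [abs_of_nonneg (Real.rpow_nonneg (hpos x).le _)]
      exact Real.rpow_le_rpow (hpos x).le (le_of_abs_le (hf.bound x)) (by linarith)
  have hm2 : 0 < ∫ x, f x ^ 2 ∂μ := by
    refine (integral_pos_iff_support_of_nonneg (fun x => sq_nonneg _) hIf2).2 ?_
    have : Function.support (fun x => f x ^ 2) = univ := by
      ext x; simp [(hpos x).ne']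
    simp [this]
  -- Expanding around the L² norm rather than the mean makes f² - m² integrate to zero.
  set m := Real.sqrt (∫ x, f x ^ 2 ∂μ) with hm
  have hm0 : 0 < m := Real.sqrt_pos.2 hm2
  have hmm : m ^ 2 = ∫ x, f x ^ 2 ∂μ := Real.sq_sqrt hm2.le
  set e := ∫ x, f x ∂μ with he
  have he0 : 0 ≤ e := integral_nonneg fun x => (hpos x).le
  have hexp : ∀ c : ℝ, ∫ x, (f x - c) ^ 2 ∂μ = m ^ 2 - 2 * c * e + c ^ 2 := by
    intro c
    have : ∀ x, (f x - c) ^ 2 = f x ^ 2 - 2 * c * f x + c ^ 2 := fun x => by ring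
    simp only [this]
    have i1 : Integrable (fun x => f x ^ 2 - 2 * c * f x) μ := hIf2.sub (hIf.const_mul _)
    rw [integral_add i1 (integrable_const _),
      integral_sub hIf2 (hIf.const_mul _), integral_const_mul, hmm]
    simp [he]
  have hvar : 0 ≤ m ^ 2 - 2 * e * e + e ^ 2 := by
    rw [← hexp]; exact integral_nonneg fun x => sq_nonneg _
  have hem : e ≤ m := abs_le_of_sq_le_sq' (by linarith) hm0.le |>.2
  set E := ∫ x, f' x ^ 2 ∂μ with hE
  have hE0 : 0 ≤ E := integral_nonneg fun x => sq_nonneg _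
  set G := ∫ x, (f x - m) ^ 2 ∂μ with hG
  have hG0 : 0 ≤ G := integral_nonneg fun x => sq_nonneg _
  have hGe := hexp m
  rw [← hG] at hGe
  have hG1 : G ≤ 2 * m ^ 2 := by nlinarith
  -- As e ≤ m, G = 2m (m - e) ≤ 2 (m² - e²), twice the variance.
  have hG2 : G ≤ 2 * P * E := by
    have h1 := h.poincare_at_zero hf
    rw [hexp] at h1
    nlinarith [sq_nonneg (f 0 - e), mul_nonneg he0 (sub_nonneg.2 hem)]
  have hg := hf.sub_const m
  have hIg : Integrable (fun x => (f x - m) ^ 2) μ :=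
    integrable_of_measurable_of_abs_le (hg.cont.pow 2).measurable fun x => by
      rw [abs_of_nonneg (sq_nonneg _)]; exact hg.sq_le x
  have hmin0 : ∀ x, 0 ≤ min 1 ((2 - p) * Φ |x|) := fun x =>
    le_min zero_le_one (mul_nonneg ha.le (h.nonneg (abs_nonneg x)))
  have hIw : Integrable (fun x => (f x - m) ^ 2 * min 1 ((2 - p) * Φ |x|)) μ :=
    integrable_of_measurable_of_abs_le (B := (M + |m|) ^ 2)
      ((hg.cont.pow 2).mul (continuous_const.min (continuous_const.mul hΦc))).measurable
      fun x => by
        rw [abs_of_nonneg (mul_nonneg (sq_nonneg _) (hmin0 x))]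
        exact (mul_le_of_le_one_right (sq_nonneg _) (min_le_left _ _)).trans (hg.sq_le x)
  have hw : ∫ x, (f x - m) ^ 2 * min 1 ((2 - p) * Φ |x|) ∂μ ≤ W * T * (G + E) := by
    have h1 := h.weighted hg ha ha1
    rwa [integral_add hIg hIf'2] at h1
  have hlog : ∀ x, max (Real.log (f x / m)) 0 ≤ K + E / m ^ 2 + Φ |x| := by
    intro x
    have hΦ0 := h.nonneg (abs_nonneg x)
    have hEm : 0 ≤ E / m ^ 2 := by positivity
    refine max_le ?_ (by linarith)
    have h1 := h.apply_sq_le_exp hf x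
    rw [integral_add hIf2 hIf'2, ← hmm, ← hE] at h1
    have h2 : (f x / m) ^ 2 ≤ K * (1 + E / m ^ 2) * Real.exp (Φ |x|) := by
      have e1 : K * (1 + E / m ^ 2) * Real.exp (Φ |x|) =
          K * (m ^ 2 + E) * Real.exp (Φ |x|) / m ^ 2 := by field_simp
      rw [e1, div_pow]
      refine div_le_div_of_nonneg_right (h1.trans ?_) (by positivity)
      gcongr
      linarith
    have h3 : 2 * Real.log (f x / m) ≤ Real.log K + Real.log (1 + E / m ^ 2) + Φ |x| := by
      have h4 := Real.log_le_log (pow_pos (div_pos (hpos x) hm0) 2) h2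
      rw [Real.log_mul (by positivity) (Real.exp_pos _).ne', Real.log_mul (by positivity)
        (by positivity), Real.log_exp, Real.log_pow] at h4
      exact_mod_cast h4
    have h5 := Real.log_le_sub_one_of_pos (by linarith : 0 < K)
    have h6 := Real.log_le_sub_one_of_pos (by linarith : 0 < 1 + E / m ^ 2)
    linarith
  -- The second-order remainder with the logarithm replaced by its bound; only Φ stays inside the
  -- minimum.
  have hpt : ∀ x, f x ^ 2 - m ^ 2 - 2 / p * (m ^ (2 - p) * f x ^ p - m ^ 2) ≤
      8 * ((2 - p) * (1 + K + E / m ^ 2) * (f x - m) ^ 2 +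
        (f x - m) ^ 2 * min 1 ((2 - p) * Φ |x|)) := by
    intro x
    refine (sq_sub_rpow_le_of_pos hp1.le hp2.le hm0 (hpos x)).trans ?_
    have h1 : min 1 ((2 - p) * (1 + max (Real.log (f x / m)) 0)) ≤
        (2 - p) * (1 + K + E / m ^ 2) + min 1 ((2 - p) * Φ |x|) := by
      have h2 : 0 ≤ (2 - p) * (1 + K + E / m ^ 2) := by positivity
      rw [← min_add_add_left]
      refine min_le_min (by linarith) ?_
      have := mul_le_mul_of_nonneg_left (hlog x) ha.le
      linarith
    have h3 := mul_le_mul_of_nonneg_left h1 (sq_nonneg (f x - m))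
    linarith
  have i1 : Integrable (fun x => f x ^ 2 - m ^ 2) μ := hIf2.sub (integrable_const _)
  have i2 : Integrable (fun x => m ^ (2 - p) * f x ^ p - m ^ 2) μ :=
    (hIfp.const_mul _).sub (integrable_const _)
  have hL : ∫ x, (f x ^ 2 - m ^ 2 - 2 / p * (m ^ (2 - p) * f x ^ p - m ^ 2)) ∂μ =
      - (2 / p * (m ^ (2 - p) * (∫ x, f x ^ p ∂μ) - m ^ 2)) := by
    rw [integral_sub i1 (i2.const_mul (2 / p)),
      integral_sub hIf2 (integrable_const _), integral_const_mul,
      integral_sub (hIfp.const_mul _) (integrable_const _), integral_const_mul, ← hmm]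
    simp
  have hR : ∫ x, 8 * ((2 - p) * (1 + K + E / m ^ 2) * (f x - m) ^ 2 +
        (f x - m) ^ 2 * min 1 ((2 - p) * Φ |x|)) ∂μ =
      8 * ((2 - p) * (1 + K + E / m ^ 2) * G +
        ∫ x, (f x - m) ^ 2 * min 1 ((2 - p) * Φ |x|) ∂μ) := by
    rw [integral_const_mul, integral_add (hIg.const_mul _) hIw, integral_const_mul]
  have hint' := integral_mono (i1.sub (i2.const_mul (2 / p)))
    (((hIg.const_mul ((2 - p) * (1 + K + E / m ^ 2))).add hIw).const_mul 8) hpt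
  simp only [Pi.sub_apply, Pi.add_apply] at hint'
  rw [hL, hR] at hint'
  -- The integrated remainder is linear in ∫ f^p, and so is this tangent to X^(2/p) at m^p; adding
  -- them leaves the deficit.
  have htan := sq_add_le_rpow hp1.le hp2.le hm0
    (integral_nonneg fun x => Real.rpow_nonneg (hpos x).le p : 0 ≤ ∫ x, f x ^ p ∂μ)
  -- G ≤ 2m² cancels the denominator.
  have hEG : E / m ^ 2 * G ≤ 2 * E := by
    rw [div_mul_eq_mul_div, div_le_iff₀ (by positivity)]
    nlinarith
  have hA : (2 - p) * ((1 + K) * G + E / m ^ 2 * G) ≤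
      κ ^ 2 * T * ((1 + K) * (2 * P * E) + 2 * E) := by
    gcongr
  have hB : W * T * (G + E) ≤ W * T * (2 * P * E + E) := by gcongr
  rw [← hmm]
  have e1 : (2 - p) * (1 + K + E / m ^ 2) * G = (2 - p) * ((1 + K) * G + E / m ^ 2 * G) := by ring
  have e2 : 8 * (κ ^ 2 * ((1 + K) * (2 * P) + 2) + W * (2 * P + 1)) * T * E =
      8 * (κ ^ 2 * T * ((1 + K) * (2 * P * E) + 2 * E) + W * T * (2 * P * E + E)) := by ring
  rw [e1] at hint'
  rw [e2]
  linarith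

/-! ### Tensorization -/

/-- Differentiation under the integral sign for bounded integrands with bounded derivatives. -/
theorem hasFDerivAt_integral_of_bounded {E : Type*} [NormedAddCommGroup E] [NormedSpace ℝ E]
    [FiniteDimensional ℝ E] {μ : Measure ℝ} [IsFiniteMeasure μ] {h : E → ℝ → ℝ}
    {h' : E → ℝ → E →L[ℝ] ℝ} {B : ℝ} (hd : ∀ x y, HasFDerivAt (fun x => h x y) (h' x y) x)
    (hc : ∀ x, Continuous (h x)) (hc' : Continuous fun z : E × ℝ => h' z.1 z.2)
    (hB : ∀ x y, |h x y| ≤ B) (hB' : ∀ x y, ‖h' x y‖ ≤ B) :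
    (∀ x, HasFDerivAt (fun x => ∫ y, h x y ∂μ) (∫ y, h' x y ∂μ) x) ∧
      Continuous fun x => ∫ y, h' x y ∂μ := by
  have hcy : ∀ x, Continuous (h' x) := fun x => hc'.comp (Continuous.prodMk_right x)
  refine ⟨fun x => ?_, ?_⟩
  · refine hasFDerivAt_integral_of_dominated_of_fderiv_le (bound := fun _ => B) univ_mem ?_ ?_ ?_ ?_
      (integrable_const _) ?_
    · exact Eventually.of_forall fun x => (hc x).aestronglyMeasurable
    · exact Integrable.of_bound (hc x).aestronglyMeasurable B (ae_of_all _ (hB x))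
    · exact (hcy x).aestronglyMeasurable
    · exact ae_of_all _ fun y x _ => hB' x y
    · exact ae_of_all _ fun y x _ => hd x y
  · refine continuous_of_dominated (bound := fun _ => B) (fun x => (hcy x).aestronglyMeasurable)
      (fun x => ae_of_all _ (hB' x)) (integrable_const _) (ae_of_all _ fun y => ?_)
    exact hc'.comp (Continuous.prodMk_left y)

/-- Expand ∫ (A b - D a)² ≥ 0 and divide by A > 0. -/
theorem sq_integral_mul_le {X : Type*} [MeasurableSpace X] {μ : Measure X} {a b : X → ℝ}
    (ha : Integrable (fun x => a x ^ 2) μ) (hb : Integrable (fun x => b x ^ 2) μ)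
    (hab : Integrable (fun x => a x * b x) μ) (hpos : 0 < ∫ x, a x ^ 2 ∂μ) :
    (∫ x, a x * b x ∂μ) ^ 2 ≤ (∫ x, a x ^ 2 ∂μ) * ∫ x, b x ^ 2 ∂μ := by
  set A := ∫ x, a x ^ 2 ∂μ
  set B := ∫ x, b x ^ 2 ∂μ
  set D := ∫ x, a x * b x ∂μ
  have h1 : 0 ≤ ∫ x, (A * b x - D * a x) ^ 2 ∂μ := integral_nonneg fun x => sq_nonneg _
  have h2 : ∀ x, (A * b x - D * a x) ^ 2 =
      A ^ 2 * b x ^ 2 + (-(2 * A * D)) * (a x * b x) + D ^ 2 * a x ^ 2 := fun x => by ring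
  have i1 : Integrable (fun x => A ^ 2 * b x ^ 2 + (-(2 * A * D)) * (a x * b x)) μ :=
    (hb.const_mul _).add (hab.const_mul _)
  simp only [h2] at h1
  rw [integral_add i1 (ha.const_mul _), integral_add (hb.const_mul _) (hab.const_mul _),
    integral_const_mul, integral_const_mul, integral_const_mul] at h1
  change 0 ≤ A ^ 2 * B + -(2 * A * D) * D + D ^ 2 * A at h1
  have h3 : 0 ≤ A * (A * B - D ^ 2) := by linarith
  have := nonneg_of_mul_nonneg_right h3 hpos
  linarith

theorem integral_rpow_le {X : Type*} [MeasurableSpace X] {μ : Measure X} [IsProbabilityMeasure μ]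
    {g : X → ℝ} (hg : ∀ x, 0 ≤ g x) {q : ℝ} (hq0 : 0 ≤ q) (hq1 : q ≤ 1) (hi : Integrable g μ)
    (hi' : Integrable (fun x => g x ^ q) μ) :
    ∫ x, g x ^ q ∂μ ≤ (∫ x, g x ∂μ) ^ q :=
  (Real.concaveOn_rpow hq0 hq1).le_map_integral
    (continuousOn_id.rpow_const fun _ _ => Or.inr hq0) isClosed_Ici (ae_of_all _ hg) hi hi'

/-- Functions on `ℝⁿ` that are `C¹`, bounded, bounded away from zero and Lipschitz. -/
structure IsTame {n : ℕ} (f : (Fin n → ℝ) → ℝ) (ε M L : ℝ) : Prop where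
  contDiff : ContDiff ℝ 1 f
  pos : 0 < ε
  lower : ∀ x, ε ≤ f x
  upper : ∀ x, f x ≤ M
  grad : ∀ x, ‖fderiv ℝ f x‖ ≤ L

namespace IsTame

variable {n : ℕ} {f : (Fin n → ℝ) → ℝ} {ε M L : ℝ}

theorem apply_pos (hf : IsTame f ε M L) (x : Fin n → ℝ) : 0 < f x := hf.pos.trans_le (hf.lower x)

theorem partial_le (hf : IsTame f ε M L) (x : Fin n → ℝ) (i : Fin n) :
    |fderiv ℝ f x (Pi.single i 1)| ≤ L := by
  have := (fderiv ℝ f x).le_of_opNorm_le (hf.grad x) (Pi.single i 1)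
  simpa [Pi.norm_single] using this

theorem continuous_partial (hf : IsTame f ε M L) (i : Fin n) :
    Continuous fun x => fderiv ℝ f x (Pi.single i 1) :=
  (hf.contDiff.continuous_fderiv one_ne_zero).clm_apply continuous_const

theorem gradSq_le (hf : IsTame f ε M L) (x : Fin n → ℝ) : |gradSq f x| ≤ n * L ^ 2 := by
  rw [abs_of_nonneg (Finset.sum_nonneg fun i _ => sq_nonneg _)]
  refine (Finset.sum_le_card_nsmul _ _ (L ^ 2) fun i _ => ?_).trans (by simp)
  exact sq_le_sq' (neg_le_of_abs_le (hf.partial_le x i)) (le_of_abs_le (hf.partial_le x i))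

theorem continuous_gradSq (hf : IsTame f ε M L) : Continuous (gradSq f) :=
  continuous_finsetSum _ fun i _ => (hf.continuous_partial i).pow 2

theorem continuous_rpow (hf : IsTame f ε M L) (q : ℝ) : Continuous fun x => f x ^ q :=
  hf.contDiff.continuous.rpow_const fun x => Or.inl (hf.apply_pos x).ne'

theorem rpow_le (hf : IsTame f ε M L) {q : ℝ} (hq : 0 ≤ q) (x : Fin n → ℝ) :
    |f x ^ q| ≤ M ^ q := by
  rw [abs_of_nonneg (Real.rpow_nonneg (hf.apply_pos x).le _)]
  exact Real.rpow_le_rpow (hf.apply_pos x).le (hf.upper x) hq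

end IsTame

/-- The linear part of `x ↦ (y, x)`. -/
def consLinear (n : ℕ) : (Fin n → ℝ) →L[ℝ] (Fin (n + 1) → ℝ) :=
  ContinuousLinearMap.pi (Fin.cons 0 fun i => ContinuousLinearMap.proj i)

theorem consLinear_single {n : ℕ} (i : Fin n) :
    consLinear n (Pi.single i 1) = Pi.single i.succ 1 := by
  ext j
  refine Fin.cases ?_ (fun j => ?_) j
  · simp [consLinear]
  · simp [consLinear, Pi.single_apply]

theorem hasFDerivAt_cons_right {n : ℕ} (y : ℝ) (x : Fin n → ℝ) :
    HasFDerivAt (fun x : Fin n → ℝ => (Fin.cons y x : Fin (n + 1) → ℝ)) (consLinear n) x := by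
  refine hasFDerivAt_pi'.2 fun j => ?_
  refine Fin.cases ?_ (fun j => ?_) j
  · exact (hasFDerivAt_const y x).congr_fderiv (by ext; simp [consLinear])
  · exact (hasFDerivAt_apply j x).congr_fderiv (by ext; simp [consLinear])

theorem hasDerivAt_cons_left {n : ℕ} (y : ℝ) (x : Fin n → ℝ) :
    HasDerivAt (fun y : ℝ => (Fin.cons y x : Fin (n + 1) → ℝ)) (Pi.single 0 1) y := by
  refine hasDerivAt_pi.2 fun j => ?_
  refine Fin.cases ?_ (fun j => ?_) j
  · simpa using hasDerivAt_id' y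
  · simpa using hasDerivAt_const y (x j)

theorem continuous_cons {n : ℕ} :
    Continuous fun z : (Fin n → ℝ) × ℝ => (Fin.cons z.2 z.1 : Fin (n + 1) → ℝ) := by
  refine continuous_pi fun j => ?_
  refine Fin.cases ?_ (fun j => ?_) j
  · simpa using continuous_snd
  · simp only [Fin.cons_succ]
    exact (continuous_apply j).comp continuous_fst

theorem integral_pi_succ {n : ℕ} {μ : Measure ℝ} [IsProbabilityMeasure μ]
    {F : (Fin (n + 1) → ℝ) → ℝ} (hF : Continuous F) {B : ℝ} (hB : ∀ z, |F z| ≤ B) :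
    ∫ z, F z ∂Measure.pi (fun _ : Fin (n + 1) => μ) =
      ∫ x, ∫ y, F (Fin.cons y x) ∂μ ∂Measure.pi (fun _ : Fin n => μ) := by
  have h1 := (measurePreserving_piFinSuccAbove (fun _ : Fin (n + 1) => μ) 0).symm
  rw [← h1.integral_comp (MeasurableEquiv.measurableEmbedding _), integral_prod_symm]
  · simp [MeasurableEquiv.piFinSuccAbove, Fin.insertNthEquiv]
  · exact integrable_of_measurable_of_abs_le (hF.measurable.comp (MeasurableEquiv.measurable _))
      fun _ => hB _

/-- The partial `L^p` norm of a tame function in its first variable. -/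
noncomputable def partialNorm {n : ℕ} (μ : Measure ℝ) (p : ℝ) (f : (Fin (n + 1) → ℝ) → ℝ) (x : Fin n → ℝ) : ℝ :=
  (∫ y, f (Fin.cons y x) ^ p ∂μ) ^ (1 / p)

namespace IsTame

variable {n : ℕ} {f : (Fin (n + 1) → ℝ) → ℝ} {ε M L : ℝ} {μ : Measure ℝ} [IsProbabilityMeasure μ]

theorem continuous_section (x : Fin n → ℝ) :
    Continuous fun y : ℝ => (Fin.cons y x : Fin (n + 1) → ℝ) :=
  continuous_cons.comp (Continuous.prodMk_right x)

theorem integrable_section (hf : IsTame f ε M L) {q : ℝ} (hq : 0 ≤ q) (x : Fin n → ℝ) :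
    Integrable (fun y => f (Fin.cons y x) ^ q) μ :=
  integrable_of_measurable_of_abs_le ((hf.continuous_rpow q).comp (continuous_section x)).measurable
    fun _ => hf.rpow_le hq _

theorem integral_section_ge (hf : IsTame f ε M L) {p : ℝ} (hp : 0 ≤ p) (x : Fin n → ℝ) :
    ε ^ p ≤ ∫ y, f (Fin.cons y x) ^ p ∂μ := by
  have := integral_mono (μ := μ) (integrable_const (ε ^ p)) (hf.integrable_section hp x)
    fun y => Real.rpow_le_rpow hf.pos.le (hf.lower _) hp
  simpa using this

theorem integral_section_le (hf : IsTame f ε M L) {p : ℝ} (hp : 0 ≤ p) (x : Fin n → ℝ) :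
    ∫ y, f (Fin.cons y x) ^ p ∂μ ≤ M ^ p := by
  have := integral_mono (μ := μ) (hf.integrable_section hp x) (integrable_const (M ^ p))
    fun y => Real.rpow_le_rpow (hf.apply_pos _).le (hf.upper _) hp
  simpa using this

theorem integral_section_pos (hf : IsTame f ε M L) {p : ℝ} (hp : 0 ≤ p) (x : Fin n → ℝ) :
    0 < ∫ y, f (Fin.cons y x) ^ p ∂μ :=
  (Real.rpow_pos_of_pos hf.pos p).trans_le (hf.integral_section_ge hp x)

/-- The derivative of `x ↦ f (y, x) ^ p`. -/
theorem hasFDerivAt_section_rpow (hf : IsTame f ε M L) (p : ℝ) (x : Fin n → ℝ) (y : ℝ) :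
    HasFDerivAt (fun x : Fin n → ℝ => f (Fin.cons y x) ^ p)
      ((p * f (Fin.cons y x) ^ (p - 1)) •
        (fderiv ℝ f (Fin.cons y x)).comp (consLinear n)) x := by
  have h1 : HasFDerivAt f (fderiv ℝ f (Fin.cons y x)) (Fin.cons y x) :=
    (hf.contDiff.differentiable one_ne_zero _).hasFDerivAt
  exact (h1.comp x (hasFDerivAt_cons_right y x)).rpow_const (Or.inl (hf.apply_pos _).ne')

theorem integral_section_deriv (hf : IsTame f ε M L) {p : ℝ} (hp : 1 ≤ p) :
    (∀ x : Fin n → ℝ, HasFDerivAt (fun x : Fin n → ℝ => ∫ y, f (Fin.cons y x) ^ p ∂μ)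
      (∫ y, (p * f (Fin.cons y x) ^ (p - 1)) •
        (fderiv ℝ f (Fin.cons y x)).comp (consLinear n) ∂μ) x) ∧
    (Continuous fun x : Fin n → ℝ => ∫ y, (p * f (Fin.cons y x) ^ (p - 1)) •
        (fderiv ℝ f (Fin.cons y x)).comp (consLinear n) ∂μ) := by
  have hM0 : 0 < M := (hf.apply_pos 0).trans_le (hf.upper 0)
  have hL0 : 0 ≤ L := (norm_nonneg _).trans (hf.grad 0)
  refine hasFDerivAt_integral_of_bounded
    (h := fun x y => f (Fin.cons y x) ^ p)
    (h' := fun x y => (p * f (Fin.cons y x) ^ (p - 1)) •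
        (fderiv ℝ f (Fin.cons y x)).comp (consLinear n))
    (B := max (M ^ p) (p * M ^ (p - 1) * (L * ‖consLinear n‖)))
    (fun x y => hf.hasFDerivAt_section_rpow p x y)
    (fun x => (hf.continuous_rpow p).comp (continuous_section x)) ?_ ?_ ?_
  · have h1 := (hf.continuous_rpow (p - 1)).comp (continuous_cons (n := n))
    have h2 := (hf.contDiff.continuous_fderiv one_ne_zero).comp (continuous_cons (n := n))
    exact (continuous_const.mul h1).smul (h2.clm_comp continuous_const)
  · exact fun x y => (hf.rpow_le (by linarith) _).trans (le_max_left _ _)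
  · intro x y
    refine le_trans ?_ (le_max_right _ _)
    rw [norm_smul, norm_mul, Real.norm_of_nonneg (by linarith : (0 : ℝ) ≤ p), Real.norm_eq_abs]
    have h1 := hf.rpow_le (by linarith : 0 ≤ p - 1) (Fin.cons y x)
    have h2 : ‖(fderiv ℝ f (Fin.cons y x)).comp (consLinear n)‖ ≤ L * ‖consLinear n‖ :=
      (ContinuousLinearMap.opNorm_comp_le _ _).trans (by gcongr; exact hf.grad _)
    have hp0 : 0 ≤ p := by linarith
    gcongr

theorem hasFDerivAt_partialNorm (hf : IsTame f ε M L) {p : ℝ} (hp : 1 ≤ p) (x : Fin n → ℝ) :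
    HasFDerivAt (partialNorm μ p f) ((1 / p * (∫ y, f (Fin.cons y x) ^ p ∂μ) ^ (1 / p - 1)) •
      ∫ y, (p * f (Fin.cons y x) ^ (p - 1)) •
        (fderiv ℝ f (Fin.cons y x)).comp (consLinear n) ∂μ) x :=
  ((hf.integral_section_deriv hp).1 x).rpow_const
    (Or.inl (hf.integral_section_pos (by linarith) x).ne')

/-- Allows the induction to be applied to the partial norm. The bounds ε and M persist; the value of
the Lipschitz constant is immaterial. -/
theorem partialNorm_tame (hf : IsTame f ε M L) {p : ℝ} (hp : 1 ≤ p) :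
    ∃ L', IsTame (partialNorm (n := n) μ p f) ε M L' := by
  have hp0 : 0 < p := by linarith
  have hM0 : 0 < M := (hf.apply_pos 0).trans_le (hf.upper 0)
  have hL0 : 0 ≤ L := (norm_nonneg _).trans (hf.grad 0)
  have hI := (hf.integral_section_deriv (μ := μ) (n := n) hp).1
  have hI' := (hf.integral_section_deriv (μ := μ) (n := n) hp).2
  have hIc : Continuous fun x : Fin n → ℝ => ∫ y, f (Fin.cons y x) ^ p ∂μ :=
    continuous_iff_continuousAt.2 fun x => (hI x).continuousAt
  refine ⟨1 / p * (ε ^ p) ^ (1 / p - 1) * (p * M ^ (p - 1) * (L * ‖consLinear n‖)), ?_⟩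
  refine ⟨?_, hf.pos, fun x => ?_, fun x => ?_, fun x => ?_⟩
  · refine contDiff_one_iff_fderiv.2
      ⟨fun x => (hf.hasFDerivAt_partialNorm hp x).differentiableAt, ?_⟩
    have : fderiv ℝ (partialNorm μ p f) = fun x : Fin n → ℝ =>
        (1 / p * (∫ y, f (Fin.cons y x) ^ p ∂μ) ^ (1 / p - 1)) •
      ∫ y, (p * f (Fin.cons y x) ^ (p - 1)) •
        (fderiv ℝ f (Fin.cons y x)).comp (consLinear n) ∂μ :=
      funext fun x => (hf.hasFDerivAt_partialNorm hp x).fderiv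
    rw [this]
    exact (continuous_const.mul (hIc.rpow_const fun x =>
      Or.inl (hf.integral_section_pos hp0.le x).ne')).smul hI'
  · have := Real.rpow_le_rpow (Real.rpow_nonneg hf.pos.le p)
      (hf.integral_section_ge (μ := μ) hp0.le x) (one_div_pos.2 hp0).le
    rwa [← Real.rpow_mul hf.pos.le, mul_one_div_cancel hp0.ne', Real.rpow_one] at this
  · have := Real.rpow_le_rpow (hf.integral_section_pos hp0.le x).le
      (hf.integral_section_le (μ := μ) hp0.le x) (one_div_pos.2 hp0).le
    rwa [← Real.rpow_mul hM0.le, mul_one_div_cancel hp0.ne', Real.rpow_one] at this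
  · rw [(hf.hasFDerivAt_partialNorm hp x).fderiv, norm_smul, norm_mul,
      Real.norm_of_nonneg (one_div_pos.2 hp0).le, Real.norm_of_nonneg
      (Real.rpow_nonneg (hf.integral_section_pos hp0.le x).le _)]
    have h1 : (∫ y, f (Fin.cons y x) ^ p ∂μ) ^ (1 / p - 1) ≤ (ε ^ p) ^ (1 / p - 1) :=
      Real.rpow_le_rpow_of_nonpos (Real.rpow_pos_of_pos hf.pos p)
        (hf.integral_section_ge hp0.le x) (by
          have := (div_le_one hp0).2 hp
          linarith)
    have h2 : ‖∫ y, (p * f (Fin.cons y x) ^ (p - 1)) •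
        (fderiv ℝ f (Fin.cons y x)).comp (consLinear n) ∂μ‖ ≤
        p * M ^ (p - 1) * (L * ‖consLinear n‖) := by
      refine (norm_integral_le_of_norm_le_const (C := p * M ^ (p - 1) * (L * ‖consLinear n‖))
        (ae_of_all _ fun y => ?_)).trans_eq (by simp)
      · rw [norm_smul, norm_mul, Real.norm_of_nonneg hp0.le, Real.norm_eq_abs]
        have h1 := hf.rpow_le (by linarith : 0 ≤ p - 1) (Fin.cons y x)
        have h2 : ‖(fderiv ℝ f (Fin.cons y x)).comp (consLinear n)‖ ≤ L * ‖consLinear n‖ :=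
          (ContinuousLinearMap.opNorm_comp_le _ _).trans (by gcongr; exact hf.grad _)
        gcongr
    have := Real.rpow_nonneg (Real.rpow_nonneg hf.pos.le p) (1 / p - 1)
    gcongr

/-- The derivative of the partial norm is I^(1/p - 1) ∫ f^(p-1) ∂f. Cauchy–Schwarz produces ∫
f^(2p-2), and Jensen bounds it by I^((2p-2)/p), as 2p - 2 ≤ p. The powers of I cancel, so no
constant is lost. -/
theorem partial_partialNorm_sq_le (hf : IsTame f ε M L) {p : ℝ} (hp1 : 1 ≤ p) (hp2 : p ≤ 2)
    (x : Fin n → ℝ) (i : Fin n) :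
    fderiv ℝ (partialNorm μ p f) x (Pi.single i 1) ^ 2 ≤
      ∫ y, fderiv ℝ f (Fin.cons y x) (Pi.single i.succ 1) ^ 2 ∂μ := by
  have hp0 : 0 < p := by linarith
  have hL0 : 0 ≤ L := (norm_nonneg _).trans (hf.grad 0)
  set I := ∫ y, f (Fin.cons y x) ^ p ∂μ with hI
  have hI0 : 0 < I := hf.integral_section_pos hp0.le x
  have hcd : Continuous fun y : ℝ => fderiv ℝ f (Fin.cons y x) (Pi.single i.succ 1) :=
    (hf.continuous_partial i.succ).comp (continuous_section x)
  have hc1 : Continuous fun y : ℝ => f (Fin.cons y x) ^ (p - 1) :=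
    (hf.continuous_rpow (p - 1)).comp (continuous_section x)
  have hsq : ∀ y : ℝ, (f (Fin.cons y x) ^ (p - 1)) ^ 2 = f (Fin.cons y x) ^ (2 * p - 2) := by
    intro y
    rw [← Real.rpow_natCast (f (Fin.cons y x) ^ (p - 1)) 2, ← Real.rpow_mul (hf.apply_pos _).le]
    congr 1
    push_cast
    ring
  have hpow : ∀ y : ℝ, f (Fin.cons y x) ^ (2 * p - 2) =
      (f (Fin.cons y x) ^ p) ^ ((2 * p - 2) / p) := by
    intro y
    rw [← Real.rpow_mul (hf.apply_pos _).le, mul_div_cancel₀ _ hp0.ne']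
  have i1 : Integrable (fun y => (f (Fin.cons y x) ^ (p - 1)) ^ 2) μ := by
    simp only [hsq]
    exact hf.integrable_section (by linarith) x
  have i2 : Integrable (fun y => fderiv ℝ f (Fin.cons y x) (Pi.single i.succ 1) ^ 2) μ := by
    refine integrable_of_measurable_of_abs_le (B := L ^ 2) (hcd.pow 2).measurable fun y => ?_
    rw [abs_of_nonneg (sq_nonneg _)]
    exact sq_le_sq' (neg_le_of_abs_le (hf.partial_le _ _)) (le_of_abs_le (hf.partial_le _ _))
  have i3 : Integrable (fun y => f (Fin.cons y x) ^ (p - 1) *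
      fderiv ℝ f (Fin.cons y x) (Pi.single i.succ 1)) μ := by
    refine integrable_of_measurable_of_abs_le (B := M ^ (p - 1) * L) (hc1.mul hcd).measurable
      fun y => ?_
    rw [abs_mul]
    have h1 := hf.rpow_le (by linarith : 0 ≤ p - 1) (Fin.cons y x)
    have h2 := hf.partial_le (Fin.cons y x) i.succ
    gcongr
    exact (abs_nonneg _).trans h1
  have hpos : 0 < ∫ y, (f (Fin.cons y x) ^ (p - 1)) ^ 2 ∂μ := by
    simp only [hsq]
    exact hf.integral_section_pos (by linarith) x
  have hJ : ∫ y, (f (Fin.cons y x) ^ (p - 1)) ^ 2 ∂μ ≤ I ^ ((2 * p - 2) / p) := by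
    simp only [hsq, hpow]
    refine integral_rpow_le (fun y => Real.rpow_nonneg (hf.apply_pos _).le _)
      (div_nonneg (by linarith) hp0.le) ((div_le_one hp0).2 (by linarith))
      (hf.integrable_section hp0.le x) ?_
    simp only [← hpow]
    exact hf.integrable_section (by linarith) x
  have hcs := sq_integral_mul_le i1 i2 i3 hpos
  set S := ∫ y, fderiv ℝ f (Fin.cons y x) (Pi.single i.succ 1) ^ 2 ∂μ
  have hS0 : 0 ≤ S := integral_nonneg fun y => sq_nonneg _
  have hval : fderiv ℝ (partialNorm μ p f) x (Pi.single i 1) =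
      I ^ (1 / p - 1) * ∫ y, f (Fin.cons y x) ^ (p - 1) *
        fderiv ℝ f (Fin.cons y x) (Pi.single i.succ 1) ∂μ := by
    have hint : Integrable (fun y => (p * f (Fin.cons y x) ^ (p - 1)) •
        (fderiv ℝ f (Fin.cons y x)).comp (consLinear n)) μ := by
      refine Integrable.of_bound (C := p * M ^ (p - 1) * (L * ‖consLinear n‖)) ?_
        (ae_of_all _ fun y => ?_)
      · have h2 := (hf.contDiff.continuous_fderiv one_ne_zero).comp (continuous_section x)
        exact ((continuous_const.mul hc1).smul
          (h2.clm_comp continuous_const)).aestronglyMeasurable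
      · rw [norm_smul, norm_mul, Real.norm_of_nonneg hp0.le, Real.norm_eq_abs]
        have h1 := hf.rpow_le (by linarith : 0 ≤ p - 1) (Fin.cons y x)
        have h2 : ‖(fderiv ℝ f (Fin.cons y x)).comp (consLinear n)‖ ≤ L * ‖consLinear n‖ :=
          (ContinuousLinearMap.opNorm_comp_le _ _).trans (by gcongr; exact hf.grad _)
        have hM := (abs_nonneg _).trans h1
        gcongr
    rw [(hf.hasFDerivAt_partialNorm hp1 x).fderiv, smul_apply,
      ContinuousLinearMap.integral_apply hint]
    simp only [smul_apply, ContinuousLinearMap.comp_apply, consLinear_single,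
      smul_eq_mul, mul_assoc]
    rw [integral_const_mul, ← hI]
    field_simp
  rw [hval, mul_pow]
  have hone : (I ^ (1 / p - 1)) ^ 2 * I ^ ((2 * p - 2) / p) = 1 := by
    rw [← Real.rpow_natCast, ← Real.rpow_mul hI0.le, ← Real.rpow_add hI0]
    have : (1 / p - 1) * ((2 : ℕ) : ℝ) + (2 * p - 2) / p = 0 := by
      push_cast
      field_simp
      ring
    rw [this, Real.rpow_zero]
  calc _ ≤ (I ^ (1 / p - 1)) ^ 2 * (I ^ ((2 * p - 2) / p) * S) := by
        gcongr
        exact hcs.trans (mul_le_mul_of_nonneg_right hJ hS0)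
    _ = S := by rw [← mul_assoc, hone, one_mul]

end IsTame

/-- Tensorization of Beckner inequalities. -/
theorem beckner_pi {μ : Measure ℝ} [IsProbabilityMeasure μ] {p K : ℝ} (hp1 : 1 ≤ p) (hp2 : p ≤ 2)
    (hK : 0 ≤ K)
    (H : ∀ (f f' : ℝ → ℝ) (M : ℝ), BddDeriv f f' M → (∀ x, 0 < f x) →
      ∫ x, f x ^ 2 ∂μ ≤ (∫ x, f x ^ p ∂μ) ^ (2 / p) + K * ∫ x, f' x ^ 2 ∂μ) (n : ℕ) :
    ∀ (f : (Fin n → ℝ) → ℝ) (ε M L : ℝ), IsTame f ε M L →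
      ∫ x, f x ^ 2 ∂Measure.pi (fun _ : Fin n => μ) ≤
        (∫ x, f x ^ p ∂Measure.pi (fun _ : Fin n => μ)) ^ (2 / p) +
          K * ∫ x, gradSq f x ∂Measure.pi (fun _ : Fin n => μ) := by
  have hp0 : 0 < p := by linarith
  induction n with
  | zero =>
    intro f ε M L hf
    have h0 : ∀ x : Fin 0 → ℝ, f x = f 0 := fun x => congrArg f (Subsingleton.elim _ _)
    have hg : ∀ x, gradSq f x = 0 := fun x => by simp [gradSq]
    have : (f 0 ^ p) ^ (2 / p) = f 0 ^ 2 := by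
      rw [← Real.rpow_mul (hf.apply_pos 0).le, mul_div_cancel₀ _ hp0.ne', Real.rpow_two]
    simp only [hg, h0, integral_const, probReal_univ, one_smul, this, smul_zero, mul_zero, add_zero,
      le_refl]
  | succ n ih =>
    intro f ε M L hf
    have hM0 : 0 < M := (hf.apply_pos 0).trans_le (hf.upper 0)
    have hL0 : 0 ≤ L := (norm_nonneg _).trans (hf.grad 0)
    obtain ⟨L', hG⟩ := hf.partialNorm_tame (μ := μ) hp1
    have hih := ih _ _ _ _ hG
    have hGpow : ∀ x, partialNorm μ p f x ^ p = ∫ y, f (Fin.cons y x) ^ p ∂μ := by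
      intro x
      rw [partialNorm, ← Real.rpow_mul (hf.integral_section_pos hp0.le x).le,
        one_div_mul_cancel hp0.ne', Real.rpow_one]
    have hGsq : ∀ x, partialNorm μ p f x ^ 2 = (∫ y, f (Fin.cons y x) ^ p ∂μ) ^ (2 / p) := by
      intro x
      rw [partialNorm, ← Real.rpow_two, ← Real.rpow_mul (hf.integral_section_pos hp0.le x).le]
      congr 1
      ring
    have hf2 : ∀ z, |f z ^ 2| ≤ M ^ 2 := by
      intro z
      simpa using hf.rpow_le (q := 2) zero_le_two z
    have hd2 : ∀ z, |fderiv ℝ f z (Pi.single 0 1) ^ 2| ≤ L ^ 2 := by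
      intro z
      rw [abs_of_nonneg (sq_nonneg _)]
      exact sq_le_sq' (neg_le_of_abs_le (hf.partial_le _ _)) (le_of_abs_le (hf.partial_le _ _))
    have hline : ∀ x : Fin n → ℝ, ∫ y, f (Fin.cons y x) ^ 2 ∂μ ≤
        partialNorm μ p f x ^ 2 +
          K * ∫ y, fderiv ℝ f (Fin.cons y x) (Pi.single 0 1) ^ 2 ∂μ := by
      intro x
      rw [hGsq]
      refine H _ _ (max M L) ⟨fun y => ?_, ?_, fun y => ?_, fun y => ?_⟩ fun y => hf.apply_pos _
      · exact ((hf.contDiff.differentiable one_ne_zero _).hasFDerivAt).comp_hasDerivAt y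
          (hasDerivAt_cons_left y x)
      · exact (hf.continuous_partial 0).comp (IsTame.continuous_section x)
      · rw [abs_of_pos (hf.apply_pos _)]
        exact (hf.upper _).trans (le_max_left _ _)
      · exact (hf.partial_le _ _).trans (le_max_right _ _)
    have hint : ∀ {F : (Fin (n + 1) → ℝ) → ℝ}, Continuous F → ∀ {B : ℝ}, (∀ z, |F z| ≤ B) →
        Integrable (fun x => ∫ y, F (Fin.cons y x) ∂μ) (Measure.pi fun _ : Fin n => μ) := by
      intro F hF B hB
      refine integrable_of_measurable_of_abs_le (B := B) (Continuous.measurable ?_) fun x => ?_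
      · refine continuous_of_dominated (bound := fun _ => B)
          (fun x => (hF.comp (IsTame.continuous_section x)).aestronglyMeasurable)
          (fun x => ae_of_all _ fun y => hB _) (integrable_const _) (ae_of_all _ fun y => ?_)
        exact hF.comp (continuous_cons.comp (Continuous.prodMk_left y))
      · have := norm_integral_le_of_norm_le_const (μ := μ) (f := fun y => F (Fin.cons y x))
          (C := B) (ae_of_all _ fun y => hB _)
        simpa using this
    have hc2 : Continuous fun z => f z ^ 2 := hf.contDiff.continuous.pow 2
    have hcd : Continuous fun z => fderiv ℝ f z (Pi.single 0 1) ^ 2 :=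
      (hf.continuous_partial 0).pow 2
    have iG2 : Integrable (fun x => partialNorm μ p f x ^ 2) (Measure.pi fun _ : Fin n => μ) :=
      integrable_of_measurable_of_abs_le (B := M ^ 2) (hG.contDiff.continuous.pow 2).measurable
        fun x => by simpa using hG.rpow_le (q := 2) zero_le_two x
    have iGg : Integrable (gradSq (partialNorm μ p f)) (Measure.pi fun _ : Fin n => μ) :=
      integrable_of_measurable_of_abs_le hG.continuous_gradSq.measurable hG.gradSq_le
    -- The energy of the partial norm and the energy in the first variable together fit into the
    -- full energy, so the same K serves in dimension n + 1.
    have hgrad : ∀ x : Fin n → ℝ,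
        gradSq (partialNorm μ p f) x + ∫ y, fderiv ℝ f (Fin.cons y x) (Pi.single 0 1) ^ 2 ∂μ ≤
          ∫ y, gradSq f (Fin.cons y x) ∂μ := by
      intro x
      have hi : ∀ j : Fin (n + 1),
          Integrable (fun y => fderiv ℝ f (Fin.cons y x) (Pi.single j 1) ^ 2) μ := by
        intro j
        refine integrable_of_measurable_of_abs_le (B := L ^ 2)
          (((hf.continuous_partial j).pow 2).comp (IsTame.continuous_section x)).measurable
          fun y => ?_
        rw [abs_of_nonneg (sq_nonneg _)]
        exact sq_le_sq' (neg_le_of_abs_le (hf.partial_le _ _)) (le_of_abs_le (hf.partial_le _ _))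
      have e : ∫ y, gradSq f (Fin.cons y x) ∂μ =
          ∑ j, ∫ y, fderiv ℝ f (Fin.cons y x) (Pi.single j 1) ^ 2 ∂μ :=
        integral_finsetSum _ fun j _ => hi j
      rw [e, Fin.sum_univ_succ, add_comm]
      gcongr
      exact Finset.sum_le_sum fun i _ => hf.partial_partialNorm_sq_le hp1 hp2 x i
    rw [integral_pi_succ hc2 hf2, integral_pi_succ (hf.continuous_rpow p) (hf.rpow_le hp0.le),
      integral_pi_succ hf.continuous_gradSq hf.gradSq_le]
    have h1 := integral_mono (hint hc2 hf2) (iG2.add ((hint hcd hd2).const_mul K)) hline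
    simp only [Pi.add_apply] at h1
    rw [integral_add iG2 ((hint hcd hd2).const_mul K), integral_const_mul] at h1
    have h2 := integral_mono (iGg.add (hint hcd hd2)) (hint hf.continuous_gradSq hf.gradSq_le) hgrad
    simp only [Pi.add_apply] at h2
    rw [integral_add iGg (hint hcd hd2)] at h2
    simp only [hGpow] at hih
    have h3 := mul_le_mul_of_nonneg_left h2 hK
    linarith

/-! ### Approximation: from tame functions to all C¹ functions -/

theorem abs_arctan_le (u : ℝ) : |Real.arctan u| ≤ |u| := by
  have key : ∀ v : ℝ, 0 ≤ v → |Real.arctan v| ≤ |v| := by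
    intro v hv
    have h0 := Real.arctan_nonneg.2 hv
    rw [abs_of_nonneg hv, abs_of_nonneg h0]
    have := Real.le_tan h0 (Real.arctan_lt_pi_div_two v)
    rwa [Real.tan_arctan] at this
  rcases le_total 0 u with h | h
  · exact key u h
  · have := key (-u) (neg_nonneg.2 h)
    rwa [Real.arctan_neg, abs_neg, abs_neg] at this

theorem abs_arctan_le_two (u : ℝ) : |Real.arctan u| ≤ 2 := by
  have h1 := Real.arctan_lt_pi_div_two u
  have h2 := Real.neg_pi_div_two_lt_arctan u
  have h3 := Real.pi_le_four
  exact abs_le.2 ⟨by linarith, by linarith⟩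

/-- Bounded `C¹` functions on `ℝⁿ` with bounded derivative. -/
structure IsBddC1 {n : ℕ} (f : (Fin n → ℝ) → ℝ) (M L : ℝ) : Prop where
  contDiff : ContDiff ℝ 1 f
  bound : ∀ x, |f x| ≤ M
  grad : ∀ x, ‖fderiv ℝ f x‖ ≤ L

section Tame

variable {n : ℕ} {f : (Fin n → ℝ) → ℝ} {M L ε : ℝ}

theorem hasFDerivAt_sqrt_sq_add (hf : IsBddC1 f M L) (hε : 0 < ε) (x : Fin n → ℝ) :
    HasFDerivAt (fun x => Real.sqrt (f x ^ 2 + ε ^ 2))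
      ((f x / Real.sqrt (f x ^ 2 + ε ^ 2)) • fderiv ℝ f x) x := by
  have h1 := (hf.contDiff.differentiable one_ne_zero x).hasFDerivAt
  have hp : f x ^ 2 + ε ^ 2 ≠ 0 := by positivity
  refine (((h1.pow 2).add_const (ε ^ 2)).sqrt hp).congr_fderiv ?_
  ext v
  simp
  field_simp

theorem abs_div_sqrt_le_one (t : ℝ) (hε : 0 < ε) : |t / Real.sqrt (t ^ 2 + ε ^ 2)| ≤ 1 := by
  have h : 0 < Real.sqrt (t ^ 2 + ε ^ 2) := Real.sqrt_pos.2 (by positivity)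
  rw [abs_div, abs_of_pos h, div_le_one h]
  refine Real.le_sqrt_of_sq_le ?_
  rw [sq_abs]
  nlinarith [sq_nonneg ε]

/-- A C¹ substitute for |f|, bounded below by ε, with no larger gradient. -/
theorem IsBddC1.sqrt_tame (hf : IsBddC1 f M L) (hε : 0 < ε) :
    IsTame (fun x => Real.sqrt (f x ^ 2 + ε ^ 2)) ε (Real.sqrt (M ^ 2 + ε ^ 2)) L where
  contDiff := ((hf.contDiff.pow 2).add contDiff_const).sqrt fun x => by positivity
  pos := hε
  lower x := Real.le_sqrt_of_sq_le (by nlinarith [sq_nonneg (f x)])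
  upper x := by
    refine Real.sqrt_le_sqrt ?_
    have : f x ^ 2 ≤ M ^ 2 := sq_le_sq' (neg_le_of_abs_le (hf.bound x)) (le_of_abs_le (hf.bound x))
    linarith
  grad x := by
    rw [(hasFDerivAt_sqrt_sq_add hf hε x).fderiv, norm_smul, Real.norm_eq_abs]
    exact (mul_le_of_le_one_left (norm_nonneg _) (abs_div_sqrt_le_one _ hε)).trans (hf.grad x)

theorem IsBddC1.gradSq_sqrt_le (hf : IsBddC1 f M L) (hε : 0 < ε) (x : Fin n → ℝ) :
    gradSq (fun x => Real.sqrt (f x ^ 2 + ε ^ 2)) x ≤ gradSq f x := by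
  refine Finset.sum_le_sum fun i _ => ?_
  rw [(hasFDerivAt_sqrt_sq_add hf hε x).fderiv, smul_apply, smul_eq_mul, mul_pow]
  refine mul_le_of_le_one_left (sq_nonneg _) ?_
  rw [← sq_abs]
  exact pow_le_one₀ (abs_nonneg _) (abs_div_sqrt_le_one _ hε)

theorem measurable_ofReal_abs_rpow (hf : Continuous f) {q : ℝ} (hq : 0 ≤ q) :
    Measurable fun x => ENNReal.ofReal (|f x| ^ q) :=
  (hf.abs.rpow_const fun _ => Or.inr hq).measurable.ennreal_ofReal

theorem IsBddC1.beckner {ν : Measure (Fin n → ℝ)} [IsProbabilityMeasure ν] {p K : ℝ}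
    (hp1 : 1 ≤ p) (hp2 : p ≤ 2) (hK : 0 ≤ K)
    (H : ∀ (f : (Fin n → ℝ) → ℝ) (ε M L : ℝ), IsTame f ε M L →
      ∫ x, f x ^ 2 ∂ν ≤ (∫ x, f x ^ p ∂ν) ^ (2 / p) + K * ∫ x, gradSq f x ∂ν)
    (hf : IsBddC1 f M L) :
    absMoment ν 2 f ≤ (absMoment ν p f) ^ (2 / p) + ENNReal.ofReal K * energy ν f := by
  have hp0 : 0 < p := by linarith
  have key : ∀ ε : ℝ, 0 < ε → absMoment ν 2 f ≤
      (absMoment ν p f + ENNReal.ofReal (ε ^ p)) ^ (2 / p) + ENNReal.ofReal K * energy ν f := by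
    intro ε hε
    have ht := hf.sqrt_tame hε
    set g : (Fin n → ℝ) → ℝ := fun x => Real.sqrt (f x ^ 2 + ε ^ 2) with hg
    have hgc := ht.contDiff.continuous
    have h1 := H g _ _ _ ht
    have i2 : Integrable (fun x => g x ^ 2) ν :=
      integrable_of_measurable_of_abs_le (hgc.pow 2).measurable fun x => by
        simpa using ht.rpow_le (q := 2) zero_le_two x
    have ip : Integrable (fun x => g x ^ p) ν :=
      integrable_of_measurable_of_abs_le (ht.continuous_rpow p).measurable (ht.rpow_le hp0.le)
    have ig : Integrable (gradSq g) ν :=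
      integrable_of_measurable_of_abs_le ht.continuous_gradSq.measurable ht.gradSq_le
    have hIp : 0 ≤ ∫ x, g x ^ p ∂ν := integral_nonneg fun x => Real.rpow_nonneg (ht.apply_pos x).le _
    have hIg : 0 ≤ ∫ x, gradSq g x ∂ν :=
      integral_nonneg fun x => Finset.sum_nonneg fun i _ => sq_nonneg _
    have hA : absMoment ν 2 f ≤ ENNReal.ofReal (∫ x, g x ^ 2 ∂ν) := by
      rw [ofReal_integral_eq_lintegral_ofReal i2 (ae_of_all _ fun x => sq_nonneg _)]
      refine lintegral_mono fun x => ENNReal.ofReal_le_ofReal ?_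
      rw [Real.rpow_two, sq_abs, Real.sq_sqrt (by positivity)]
      nlinarith [sq_nonneg ε]
    have hB : ENNReal.ofReal (∫ x, g x ^ p ∂ν) ≤ absMoment ν p f + ENNReal.ofReal (ε ^ p) := by
      rw [ofReal_integral_eq_lintegral_ofReal ip
        (ae_of_all _ fun x => Real.rpow_nonneg (ht.apply_pos x).le _)]
      have e : absMoment ν p f + ENNReal.ofReal (ε ^ p) =
          ∫⁻ x, (ENNReal.ofReal (|f x| ^ p) + ENNReal.ofReal (ε ^ p)) ∂ν := by
        rw [lintegral_add_right _ measurable_const, lintegral_const, measure_univ, mul_one]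
        rfl
      rw [e]
      refine lintegral_mono fun x => ?_
      rw [← ENNReal.ofReal_add (by positivity) (by positivity)]
      refine ENNReal.ofReal_le_ofReal ?_
      -- Since p/2 ≤ 1, (f² + ε²)^(p/2) ≤ |f|^p + ε^p.
      have h2 := Real.rpow_add_le_add_rpow (sq_nonneg (f x)) (sq_nonneg ε)
        (by positivity : 0 ≤ p / 2) (by linarith)
      have e1 : ∀ t : ℝ, 0 ≤ t → (t ^ 2) ^ (p / 2) = t ^ p := by
        intro t ht
        rw [← Real.rpow_two, ← Real.rpow_mul ht, mul_div_cancel₀ _ two_ne_zero]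
      rw [e1 ε hε.le, ← sq_abs (f x), e1 _ (abs_nonneg _)] at h2
      refine le_trans (le_of_eq ?_) h2
      simp only [hg]
      rw [Real.sqrt_eq_rpow, ← Real.rpow_mul (by positivity), sq_abs]
      congr 1
      ring
    have hC : ENNReal.ofReal (∫ x, gradSq g x ∂ν) ≤ energy ν f := by
      rw [ofReal_integral_eq_lintegral_ofReal ig
        (ae_of_all _ fun x => Finset.sum_nonneg fun i _ => sq_nonneg _)]
      exact lintegral_mono fun x => ENNReal.ofReal_le_ofReal (hf.gradSq_sqrt_le hε x)
    refine hA.trans ((ENNReal.ofReal_le_ofReal h1).trans ?_)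
    rw [ENNReal.ofReal_add (Real.rpow_nonneg hIp _) (mul_nonneg hK hIg), ENNReal.ofReal_mul hK,
      ← ENNReal.ofReal_rpow_of_nonneg hIp (by positivity)]
    gcongr
  have hlim : Tendsto (fun ε : ℝ => (absMoment ν p f + ENNReal.ofReal (ε ^ p)) ^ (2 / p) +
      ENNReal.ofReal K * energy ν f) (𝓝[>] 0)
      (𝓝 ((absMoment ν p f) ^ (2 / p) + ENNReal.ofReal K * energy ν f)) := by
    have h1 : Tendsto (fun ε : ℝ => ENNReal.ofReal (ε ^ p)) (𝓝[>] 0) (𝓝 0) := by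
      have : Continuous fun ε : ℝ => ENNReal.ofReal (ε ^ p) :=
        ENNReal.continuous_ofReal.comp (Real.continuous_rpow_const hp0.le)
      have h2 := (this.tendsto 0).mono_left (nhdsWithin_le_nhds (s := Ioi 0))
      rwa [Real.zero_rpow hp0.ne', ENNReal.ofReal_zero] at h2
    have h3 := tendsto_const_nhds (x := absMoment ν p f).add h1
    rw [add_zero] at h3
    exact ((ENNReal.continuous_rpow_const.tendsto _).comp h3).add tendsto_const_nhds
  refine ge_of_tendsto hlim ?_
  filter_upwards [self_mem_nhdsWithin] with ε hε using key ε hε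

end Tame

/-- Truncation and cut-off of a function: `h⁻¹ arctan (h f(x)) χ(h² x)`. -/
noncomputable def cutoff {n : ℕ} (χ f : (Fin n → ℝ) → ℝ) (h : ℝ) (x : Fin n → ℝ) : ℝ :=
  h⁻¹ * Real.arctan (h * f x) * χ (h ^ 2 • x)

section Cutoff

variable {n : ℕ} {χ f : (Fin n → ℝ) → ℝ} {h K : ℝ}

theorem abs_inv_mul_arctan_le (hh : 0 < h) (t : ℝ) : |h⁻¹ * Real.arctan (h * t)| ≤ |t| := by
  have := abs_arctan_le (h * t)
  rw [abs_mul, abs_of_pos hh] at this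
  rw [abs_mul, abs_inv, abs_of_pos hh, inv_mul_le_iff₀ hh]
  exact this

theorem abs_cutoff_le (hχ : ∀ x, |χ x| ≤ 1) (hh : 0 < h) (x : Fin n → ℝ) :
    |cutoff χ f h x| ≤ |f x| := by
  rw [cutoff, abs_mul]
  exact (mul_le_of_le_one_right (abs_nonneg _) (hχ _)).trans (abs_inv_mul_arctan_le hh _)

theorem hasFDerivAt_cutoff (hχ : Differentiable ℝ χ) (hf : Differentiable ℝ f) (hh : 0 < h)
    (x : Fin n → ℝ) :
    HasFDerivAt (cutoff χ f h)
      ((h⁻¹ * Real.arctan (h * f x)) • (h ^ 2 • fderiv ℝ χ (h ^ 2 • x)) +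
        χ (h ^ 2 • x) • ((1 / (1 + (h * f x) ^ 2)) • fderiv ℝ f x)) x := by
  have h1 := (((hf x).hasFDerivAt.const_mul h).arctan).const_mul h⁻¹
  have h2 : HasFDerivAt (fun x => χ (h ^ 2 • x)) (h ^ 2 • fderiv ℝ χ (h ^ 2 • x)) x := by
    have h3 : HasFDerivAt (fun x : Fin n → ℝ => h ^ 2 • x)
        (h ^ 2 • ContinuousLinearMap.id ℝ (Fin n → ℝ)) x := (hasFDerivAt_id x).const_smul (h ^ 2)
    refine ((hχ _).hasFDerivAt.comp x h3).congr_fderiv ?_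
    ext v
    simp
  refine (h1.mul h2).congr_fderiv ?_
  ext v
  simp
  field_simp
  simp

theorem contDiff_cutoff (hχ : ContDiff ℝ 1 χ) (hf : ContDiff ℝ 1 f) : ContDiff ℝ 1 (cutoff χ f h) :=
  (contDiff_const.mul (contDiff_const.mul hf).arctan).mul
    (hχ.comp (contDiff_const_smul (h ^ 2)))

theorem exists_isBddC1_cutoff (hχ : ContDiff ℝ 1 χ) (hχc : HasCompactSupport χ)
    (hf : ContDiff ℝ 1 f) (hh : 0 < h) : ∃ M L, IsBddC1 (cutoff χ f h) M L := by
  have hc : ContDiff ℝ 1 (cutoff χ f h) := contDiff_cutoff hχ hf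
  have hs : HasCompactSupport (cutoff χ f h) := by
    have h1 : HasCompactSupport fun x : Fin n → ℝ => χ (h ^ 2 • x) :=
      hχc.comp_homeomorph (Homeomorph.smulOfNeZero (h ^ 2) (by positivity))
    exact h1.mul_left
  obtain ⟨M, hM⟩ := hc.continuous.bounded_above_of_compact_support hs
  obtain ⟨L, hL⟩ := (hc.continuous_fderiv one_ne_zero).bounded_above_of_compact_support
    (hs.fderiv ℝ)
  exact ⟨M, L, hc, hM, hL⟩

/-- The truncation is of size 1/h, while the cutoff at scale h⁻² has gradient of order h², so their
product is of order h. -/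
theorem gradSq_cutoff_le (hχ : ContDiff ℝ 1 χ) (hχ1 : ∀ x, |χ x| ≤ 1)
    (hK : ∀ x, ‖fderiv ℝ χ x‖ ≤ K) (hf : ContDiff ℝ 1 f) (hh : 0 < h) (x : Fin n → ℝ) :
    gradSq (cutoff χ f h) x ≤ (1 + h) * gradSq f x + n * (4 * K ^ 2 * (h ^ 2 + h)) := by
  have hsum : (n : ℝ) * (4 * K ^ 2 * (h ^ 2 + h)) = ∑ _i : Fin n, 4 * K ^ 2 * (h ^ 2 + h) := by
    simp
  rw [gradSq, gradSq, Finset.mul_sum, hsum, ← Finset.sum_add_distrib]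
  refine Finset.sum_le_sum fun i _ => ?_
  rw [(hasFDerivAt_cutoff (hχ.differentiable one_ne_zero) (hf.differentiable one_ne_zero) hh
    x).fderiv]
  simp only [add_apply, smul_apply, smul_eq_mul]
  set D := fderiv ℝ f x (Pi.single i 1)
  have h1 : |fderiv ℝ χ (h ^ 2 • x) (Pi.single i 1)| ≤ K := by
    have := (fderiv ℝ χ (h ^ 2 • x)).le_of_opNorm_le (hK _) (Pi.single i 1)
    simpa [Pi.norm_single] using this
  have hv : |h⁻¹ * Real.arctan (h * f x) *
      (h ^ 2 * fderiv ℝ χ (h ^ 2 • x) (Pi.single i 1))| ≤ 2 * h * K := by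
    have e : h⁻¹ * Real.arctan (h * f x) * (h ^ 2 * fderiv ℝ χ (h ^ 2 • x) (Pi.single i 1)) =
        h * (Real.arctan (h * f x) * fderiv ℝ χ (h ^ 2 • x) (Pi.single i 1)) := by
      field_simp
    rw [e, abs_mul, abs_mul, abs_of_pos hh]
    have h2 := abs_arctan_le_two (h * f x)
    calc h * (|Real.arctan (h * f x)| * |fderiv ℝ χ (h ^ 2 • x) (Pi.single i 1)|)
        ≤ h * (2 * K) := by gcongr
      _ = 2 * h * K := by ring
  have hu : |χ (h ^ 2 • x) * (1 / (1 + (h * f x) ^ 2) * D)| ≤ |D| := by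
    have h3 : |1 / (1 + (h * f x) ^ 2)| ≤ 1 := by
      rw [abs_of_nonneg (by positivity)]
      exact (div_le_one (by positivity)).2 (by nlinarith [sq_nonneg (h * f x)])
    rw [abs_mul, abs_mul]
    exact (mul_le_of_le_one_left (by positivity) (hχ1 _)).trans
      (mul_le_of_le_one_left (abs_nonneg _) h3)
  set v := h⁻¹ * Real.arctan (h * f x) * (h ^ 2 * fderiv ℝ χ (h ^ 2 • x) (Pi.single i 1))
  set u := χ (h ^ 2 • x) * (1 / (1 + (h * f x) ^ 2) * D)
  have hu2 : u ^ 2 ≤ D ^ 2 := sq_le_sq.2 hu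
  have hv2 : v ^ 2 ≤ (2 * h * K) ^ 2 := by
    rw [← sq_abs v]
    exact pow_le_pow_left₀ (abs_nonneg _) hv 2
  -- Young's inequality with weight h: the factor on u² tends to 1, and (1 + 1/h) v² still vanishes
  -- because v is of order h.
  have hcs : (v + u) ^ 2 ≤ (1 + h) * u ^ 2 + (1 + h⁻¹) * v ^ 2 := by
    have h4 : 0 ≤ h⁻¹ * (h * u - v) ^ 2 := by positivity
    have e : h⁻¹ * (h * u - v) ^ 2 = h * u ^ 2 - 2 * u * v + h⁻¹ * v ^ 2 := by
      field_simp
      ring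
    nlinarith
  have e2 : (1 + h⁻¹) * (2 * h * K) ^ 2 = 4 * K ^ 2 * (h ^ 2 + h) := by
    field_simp
    ring
  rw [← e2]
  refine hcs.trans ?_
  gcongr

/-- The quotient arctan(h f(x))/h tends to the derivative of h ↦ arctan(h f(x)) at 0, which is f(x).
-/
theorem tendsto_cutoff (hχ : ContinuousAt χ 0) (hχ0 : χ 0 = 1) (x : Fin n → ℝ) :
    Tendsto (fun h => cutoff χ f h x) (𝓝[>] 0) (𝓝 (f x)) := by
  have h1 : HasDerivAt (fun h : ℝ => Real.arctan (h * f x)) (f x) 0 := by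
    have h2 : HasDerivAt (fun h : ℝ => h * f x) (f x) 0 := by
      simpa using (hasDerivAt_id (0 : ℝ)).mul_const (f x)
    have h3 := h2.arctan
    simpa using h3
  have h4 := h1.tendsto_slope_zero_right
  simp only [zero_add, zero_mul, Real.arctan_zero, sub_zero, smul_eq_mul] at h4
  have h5 : Tendsto (fun h : ℝ => χ (h ^ 2 • x)) (𝓝[>] 0) (𝓝 1) := by
    have h6 : Tendsto (fun h : ℝ => h ^ 2 • x) (𝓝[>] 0) (𝓝 0) := by
      have : Continuous fun h : ℝ => h ^ 2 • x := by fun_prop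
      simpa using (this.tendsto 0).mono_left (nhdsWithin_le_nhds (s := Ioi 0))
    have := hχ.tendsto.comp h6
    rwa [hχ0] at this
  simpa [cutoff] using h4.mul h5

/-- Functional inequalities extend from bounded `C¹` functions with bounded derivative to all
`C¹` functions. -/
theorem le_of_forall_isBddC1 {ν : Measure (Fin n → ℝ)} [IsProbabilityMeasure ν] {k : ℝ}
    (hk : 0 < k) {Ψ : ((Fin n → ℝ) → ℝ) → ENNReal}
    (hΨ : ∀ f g : (Fin n → ℝ) → ℝ, (∀ x, |g x| ≤ |f x|) → Ψ g ≤ Ψ f)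
    (H : ∀ (f : (Fin n → ℝ) → ℝ) (M L : ℝ), IsBddC1 f M L →
      absMoment ν 2 f ≤ Ψ f + ENNReal.ofReal k * energy ν f)
    (hf : ContDiff ℝ 1 f) : absMoment ν 2 f ≤ Ψ f + ENNReal.ofReal k * energy ν f := by
  by_cases hE : energy ν f = ⊤
  · rw [hE, ENNReal.mul_top (by simpa using hk), add_top]
    exact le_top
  let b : ContDiffBump (0 : Fin n → ℝ) := ⟨1, 2, one_pos, one_lt_two⟩
  have hb : ContDiff ℝ 1 b := b.contDiff (n := 1)
  have hb1 : ∀ x, |b x| ≤ 1 := fun x => by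
    rw [abs_of_nonneg b.nonneg]; exact b.le_one
  have hb0 : b 0 = 1 := b.one_of_mem_closedBall (Metric.mem_closedBall_self zero_le_one)
  obtain ⟨K, hK⟩ := (hb.continuous_fderiv one_ne_zero).bounded_above_of_compact_support
    (b.hasCompactSupport.fderiv ℝ)
  have hmeas : Measurable fun x => ENNReal.ofReal (gradSq f x) :=
    (continuous_finsetSum _ fun i _ => ((hf.continuous_fderiv one_ne_zero).clm_apply
      continuous_const).pow 2).measurable.ennreal_ofReal
  have hen : ∀ h : ℝ, 0 < h → energy ν (cutoff b f h) ≤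
      ENNReal.ofReal (1 + h) * energy ν f + ENNReal.ofReal (n * (4 * K ^ 2 * (h ^ 2 + h))) := by
    intro h hh
    have e : ENNReal.ofReal (1 + h) * energy ν f +
        ENNReal.ofReal (n * (4 * K ^ 2 * (h ^ 2 + h))) =
        ∫⁻ x, (ENNReal.ofReal (1 + h) * ENNReal.ofReal (gradSq f x) +
          ENNReal.ofReal (n * (4 * K ^ 2 * (h ^ 2 + h)))) ∂ν := by
      rw [lintegral_add_right _ measurable_const, lintegral_const, measure_univ, mul_one,
        lintegral_const_mul _ hmeas]
      rfl
    rw [e]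
    refine lintegral_mono fun x => ?_
    have hg : 0 ≤ gradSq f x := Finset.sum_nonneg fun i _ => sq_nonneg _
    rw [← ENNReal.ofReal_mul (by positivity), ← ENNReal.ofReal_add (by positivity) (by positivity)]
    exact ENNReal.ofReal_le_ofReal (gradSq_cutoff_le hb hb1 hK hf hh x)
  have hlim : Tendsto (fun h : ℝ => Ψ f + ENNReal.ofReal k * (ENNReal.ofReal (1 + h) * energy ν f +
      ENNReal.ofReal (n * (4 * K ^ 2 * (h ^ 2 + h))))) (𝓝[>] 0)
      (𝓝 (Ψ f + ENNReal.ofReal k * energy ν f)) := by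
    have c1 : Continuous fun h : ℝ => ENNReal.ofReal (1 + h) :=
      ENNReal.continuous_ofReal.comp (by fun_prop)
    have c2 : Continuous fun h : ℝ => ENNReal.ofReal (n * (4 * K ^ 2 * (h ^ 2 + h))) :=
      ENNReal.continuous_ofReal.comp (by fun_prop)
    have t1 := (c1.tendsto 0).mono_left (nhdsWithin_le_nhds (s := Ioi 0))
    have t2 := (c2.tendsto 0).mono_left (nhdsWithin_le_nhds (s := Ioi 0))
    simp only [add_zero, ENNReal.ofReal_one, ne_eq, OfNat.ofNat_ne_zero, not_false_eq_true,
      zero_pow, mul_zero, ENNReal.ofReal_zero] at t1 t2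
    have t3 := (ENNReal.Tendsto.mul_const t1 (Or.inr hE)).add t2
    rw [one_mul, add_zero] at t3
    exact tendsto_const_nhds.add (ENNReal.Tendsto.const_mul t3 (Or.inr ENNReal.ofReal_ne_top))
  let u : ℕ → ℝ := fun j => 1 / ((j : ℝ) + 1)
  have hu0 : ∀ j, 0 < u j := fun j => by positivity
  have hu : Tendsto u atTop (𝓝[>] 0) :=
    tendsto_nhdsWithin_iff.2 ⟨tendsto_one_div_add_atTop_nhds_zero_nat,
      Eventually.of_forall fun j => hu0 j⟩
  have hbound : ∀ j, absMoment ν 2 (cutoff b f (u j)) ≤ Ψ f + ENNReal.ofReal k *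
      (ENNReal.ofReal (1 + u j) * energy ν f +
        ENNReal.ofReal (n * (4 * K ^ 2 * (u j ^ 2 + u j)))) := by
    intro j
    obtain ⟨M, L, hML⟩ := exists_isBddC1_cutoff hb b.hasCompactSupport hf (hu0 j)
    refine (H _ M L hML).trans ?_
    gcongr
    · exact hΨ _ _ (abs_cutoff_le hb1 (hu0 j))
    · exact hen _ (hu0 j)
  have hcont : ∀ j, Measurable fun x => ENNReal.ofReal (|cutoff b f (u j) x| ^ (2 : ℝ)) := fun j =>
    measurable_ofReal_abs_rpow (contDiff_cutoff hb hf).continuous zero_le_two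
  have hpt : ∀ x, ENNReal.ofReal (|f x| ^ (2 : ℝ)) =
      liminf (fun j => ENNReal.ofReal (|cutoff b f (u j) x| ^ (2 : ℝ))) atTop := by
    intro x
    refine (Tendsto.liminf_eq ?_).symm
    have h1 := (tendsto_cutoff (f := f) b.continuous.continuousAt hb0 x).comp hu
    have c : Continuous fun t : ℝ => ENNReal.ofReal (|t| ^ (2 : ℝ)) :=
      ENNReal.continuous_ofReal.comp (continuous_abs.rpow_const fun _ => Or.inr zero_le_two)
    exact (c.tendsto _).comp h1
  -- Fatou handles the left side; on the right Ψ only decreases under |cutoff| ≤ |f|, so no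
  -- convergence of Ψ is needed.
  calc absMoment ν 2 f
      = ∫⁻ x, liminf (fun j => ENNReal.ofReal (|cutoff b f (u j) x| ^ (2 : ℝ))) atTop ∂ν :=
        lintegral_congr hpt
    _ ≤ liminf (fun j => absMoment ν 2 (cutoff b f (u j))) atTop := lintegral_liminf_le hcont
    _ ≤ liminf (fun j => Ψ f + ENNReal.ofReal k * (ENNReal.ofReal (1 + u j) * energy ν f +
          ENNReal.ofReal (n * (4 * K ^ 2 * (u j ^ 2 + u j))))) atTop :=
        liminf_le_liminf (Eventually.of_forall hbound)
    _ = _ := (hlim.comp hu).liminf_eq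

end Cutoff

/-! ### Interpolation of moments and choice of the exponent -/

theorem absMoment_mono {n : ℕ} {ν : Measure (Fin n → ℝ)} {p : ℝ} (hp : 0 ≤ p)
    {f g : (Fin n → ℝ) → ℝ} (h : ∀ x, |g x| ≤ |f x|) : absMoment ν p g ≤ absMoment ν p f :=
  lintegral_mono fun x => ENNReal.ofReal_le_ofReal (Real.rpow_le_rpow (abs_nonneg _) (h x) hp)

/-- Hölder interpolation of the `p`-th moment between the first and the second one. -/
theorem absMoment_interpolation {n : ℕ} {ν : Measure (Fin n → ℝ)} {p : ℝ} (hp1 : 1 ≤ p)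
    (hp2 : p ≤ 2) {f : (Fin n → ℝ) → ℝ} (hf : Continuous f) :
    absMoment ν p f ≤ absMoment ν 1 f ^ (2 - p) * absMoment ν 2 f ^ (p - 1) := by
  refine le_trans (le_of_eq ?_) (ENNReal.lintegral_mul_norm_pow_le
    (measurable_ofReal_abs_rpow hf zero_le_one).aemeasurable
    (measurable_ofReal_abs_rpow hf zero_le_two).aemeasurable (by linarith : 0 ≤ 2 - p)
    (by linarith : 0 ≤ p - 1) (by ring))
  refine lintegral_congr fun x => ?_
  have h0 := abs_nonneg (f x)
  rw [ENNReal.ofReal_rpow_of_nonneg (by positivity) (by linarith),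
    ENNReal.ofReal_rpow_of_nonneg (by positivity) (by linarith),
    ← ENNReal.ofReal_mul (by positivity), ← Real.rpow_mul h0, ← Real.rpow_mul h0,
    ← Real.rpow_add_of_nonneg h0 (by linarith) (by linarith)]
  congr 2
  ring

theorem absMoment_ne_top {n : ℕ} {ν : Measure (Fin n → ℝ)} [IsProbabilityMeasure ν] {p : ℝ}
    (hp : 0 ≤ p) {f : (Fin n → ℝ) → ℝ} {M L : ℝ} (hf : IsBddC1 f M L) : absMoment ν p f ≠ ⊤ := by
  refine ne_top_of_le_ne_top (ENNReal.ofReal_ne_top (r := M ^ p)) ?_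
  refine (lintegral_mono fun x => ENNReal.ofReal_le_ofReal
    (Real.rpow_le_rpow (abs_nonneg _) (hf.bound x) hp)).trans_eq ?_
  simp

theorem energy_ne_top {n : ℕ} {ν : Measure (Fin n → ℝ)} [IsProbabilityMeasure ν]
    {f : (Fin n → ℝ) → ℝ} {M L : ℝ} (hf : IsBddC1 f M L) : energy ν f ≠ ⊤ := by
  refine ne_top_of_le_ne_top (ENNReal.ofReal_ne_top (r := n * L ^ 2)) ?_
  refine (lintegral_mono fun x => ENNReal.ofReal_le_ofReal (?_ : gradSq f x ≤ n * L ^ 2)).trans_eq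
    (by simp)
  refine (Finset.sum_le_card_nsmul _ _ (L ^ 2) fun i _ => ?_).trans (by simp)
  have := (fderiv ℝ f x).le_of_opNorm_le (hf.grad x) (Pi.single i 1)
  rw [Pi.norm_single, norm_one, mul_one, Real.norm_eq_abs] at this
  exact sq_le_sq' (neg_le_of_abs_le this) (le_of_abs_le this)

/-- A Beckner inequality in real form, interpolated between first and second moments. -/
theorem toReal_absMoment_two_le {n : ℕ} {ν : Measure (Fin n → ℝ)} [IsProbabilityMeasure ν]
    {p K : ℝ} (hp1 : 1 ≤ p) (hp2 : p ≤ 2) (hK : 0 ≤ K) {f : (Fin n → ℝ) → ℝ} {M L : ℝ}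
    (hf : IsBddC1 f M L)
    (H : absMoment ν 2 f ≤ absMoment ν p f ^ (2 / p) + ENNReal.ofReal K * energy ν f) :
    (absMoment ν 2 f).toReal ≤ ((absMoment ν 1 f).toReal ^ 2) ^ ((2 - p) / p) *
      (absMoment ν 2 f).toReal ^ (1 - (2 - p) / p) + K * (energy ν f).toReal := by
  have hp0 : 0 < p := by linarith
  have h1 := absMoment_ne_top (ν := ν) zero_le_one hf
  have h2 := absMoment_ne_top (ν := ν) zero_le_two hf
  have hE := energy_ne_top (ν := ν) hf
  have hi := absMoment_interpolation (ν := ν) hp1 hp2 hf.contDiff.continuous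
  have hi2 := ENNReal.rpow_le_rpow hi (by positivity : 0 ≤ 2 / p)
  have h3 := H.trans (add_le_add_left hi2 _)
  have hf1 : absMoment ν 1 f ^ (2 - p) ≠ ⊤ := ENNReal.rpow_ne_top_of_nonneg (by linarith) h1
  have hf2 : absMoment ν 2 f ^ (p - 1) ≠ ⊤ := ENNReal.rpow_ne_top_of_nonneg (by linarith) h2
  have h4 := ENNReal.toReal_mono (ENNReal.add_ne_top.2
    ⟨ENNReal.rpow_ne_top_of_nonneg (by positivity) (ENNReal.mul_ne_top hf1 hf2),
      ENNReal.mul_ne_top ENNReal.ofReal_ne_top hE⟩) h3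
  rw [ENNReal.toReal_add (ENNReal.rpow_ne_top_of_nonneg (by positivity)
    (ENNReal.mul_ne_top hf1 hf2)) (ENNReal.mul_ne_top ENNReal.ofReal_ne_top hE),
    ENNReal.toReal_mul, ENNReal.toReal_ofReal hK, ← ENNReal.toReal_rpow, ENNReal.toReal_mul,
    ← ENNReal.toReal_rpow, ← ENNReal.toReal_rpow] at h4
  refine h4.trans_eq ?_
  have hx := ENNReal.toReal_nonneg (a := absMoment ν 2 f)
  have hy := ENNReal.toReal_nonneg (a := absMoment ν 1 f)
  rw [Real.mul_rpow (by positivity) (by positivity), ← Real.rpow_mul hx, ← Real.rpow_mul hy,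
    ← Real.rpow_two, ← Real.rpow_mul hy]
  congr 3
  · ring
  · field_simp
    ring

/-- From an interpolated inequality at the exponent adapted to `s` to an inequality at level `s`. -/
theorem le_of_interpolated {x y e s θ : ℝ} (hx : 0 ≤ x) (hy : 0 ≤ y) (he : 0 ≤ e)
    (hs : Real.exp 1 - 1 < s) (hθ : 1 / (2 * Real.log (1 + s)) ≤ θ)
    (h : x ≤ y ^ θ * x ^ (1 - θ) + e) : x ≤ s * y + 48 * e := by
  have hs1 : 1.7 < s := by
    have := Real.exp_one_gt_d9
    norm_num at this ⊢
    linarith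
  have hs0 : 0 < s := by linarith
  -- If x > s y, then y^θ x^(1-θ) ≤ x / s^θ, which is at most 6x/7.
  by_cases hxy : x ≤ s * y
  · linarith
  push Not at hxy
  have hx0 : 0 < x := lt_of_le_of_lt (by positivity) hxy
  have hlog1 : 0 < Real.log (1 + s) := Real.log_pos (by linarith)
  have hθ0 : 0 < θ := lt_of_lt_of_le (by positivity) hθ
  -- 1 + s ≤ s³ for s > 1.7, so θ log s ≥ 1/6 and s^θ ≥ 7/6.
  have hlog : Real.log (1 + s) ≤ 3 * Real.log s := by
    have : Real.log (1 + s) ≤ Real.log (s ^ 3) := by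
      refine Real.log_le_log (by linarith) ?_
      nlinarith [mul_pos hs0 hs0, mul_pos (sub_pos.2 hs1) (sub_pos.2 hs1)]
    rwa [Real.log_pow] at this
  have hθs : 1 / 6 ≤ θ * Real.log s := by
    have h1 : 1 / (2 * Real.log (1 + s)) * (Real.log (1 + s) / 3) ≤ θ * Real.log s := by
      gcongr
      linarith
    have e1 : 1 / (2 * Real.log (1 + s)) * (Real.log (1 + s) / 3) = 1 / 6 := by
      field_simp
      norm_num
    linarith
  have hsθ : 7 / 6 ≤ s ^ θ := by
    rw [Real.rpow_def_of_pos hs0]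
    have := Real.add_one_le_exp (Real.log s * θ)
    linarith
  have h2 : y ^ θ * x ^ (1 - θ) ≤ x / s ^ θ := by
    have h3 : y ^ θ ≤ (x / s) ^ θ := by
      refine Real.rpow_le_rpow hy ?_ hθ0.le
      rw [le_div_iff₀ hs0]; linarith
    calc y ^ θ * x ^ (1 - θ) ≤ (x / s) ^ θ * x ^ (1 - θ) := by gcongr
      _ = x / s ^ θ := by
        rw [Real.div_rpow hx hs0.le, div_mul_eq_mul_div, ← Real.rpow_add hx0, add_sub_cancel,
          Real.rpow_one]
  have h4 : x / s ^ θ ≤ x * (6 / 7) := by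
    rw [div_le_iff₀ (by linarith)]
    nlinarith
  have : 0 ≤ s * y := by positivity
  -- x ≤ 6x/7 + e gives x ≤ 7e, well within 48e.
  linarith

/-- The limiting case of an interpolated inequality as the exponent tends to one. -/
theorem le_of_interpolated_limit {x y e : ℝ} (hx : 0 ≤ x) (hy : 0 ≤ y) (he : 0 ≤ e)
    (h : ∀ p ∈ Ioo (1 : ℝ) 2, x ≤ y ^ ((2 - p) / p) * x ^ (1 - (2 - p) / p) + e) : x ≤ y + e := by
  rcases hx.eq_or_lt with rfl | hx0
  · positivity
  -- The exponents tend to 1 and 0; the second needs x ≠ 0, the base of a power with exponent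
  -- tending to 0.
  have hc : ContinuousAt (fun p : ℝ => (2 - p) / p) 1 :=
    (continuousAt_const.sub continuousAt_id).div continuousAt_id one_ne_zero
  have h1 : ContinuousAt (fun p : ℝ => y ^ ((2 - p) / p)) 1 :=
    ContinuousAt.comp (f := fun p : ℝ => (2 - p) / p) (g := fun t : ℝ => y ^ t)
      (Real.continuousAt_const_rpow' (by norm_num)) hc
  have h2 : ContinuousAt (fun p : ℝ => x ^ (1 - (2 - p) / p)) 1 :=
    ContinuousAt.comp (f := fun p : ℝ => 1 - (2 - p) / p) (g := fun t : ℝ => x ^ t)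
      (Real.continuousAt_const_rpow hx0.ne') (continuousAt_const.sub hc)
  have h3 := (((h1.mul h2).add (continuousAt_const (y := e))).tendsto).mono_left
    (nhdsWithin_le_nhds (s := Ioi 1))
  have h4 : x ≤ y ^ ((2 - (1 : ℝ)) / 1) * x ^ (1 - (2 - (1 : ℝ)) / 1) + e := by
    refine ge_of_tendsto h3 ?_
    filter_upwards [Ioo_mem_nhdsGT (by norm_num : (1 : ℝ) < 2)] with p hp using h p hp
  norm_num at h4
  exact h4

namespace IsPotential

variable {Φ : ℝ → ℝ}

/-- Φ' and Φ⁻¹ are nondecreasing, so T is nondecreasing; this frees the rate from p before p tends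
to 1. -/
theorem becknerRate_le_one (h : IsPotential Φ) {a : ℝ} (ha : 0 < a) (ha1 : a ≤ 1) :
    becknerRate Φ a ≤ becknerRate Φ 1 := by
  have h1 := h.inv_pos (one_div_pos.2 (one_pos : (0 : ℝ) < 1))
  have h2 : potentialInv Φ (1 / 1) ≤ potentialInv Φ (1 / a) :=
    h.inv_mono (by norm_num) (one_div_le_one_div_of_le ha ha1)
  have h3 := h.monotoneOn_deriv (mem_Ioi.2 h1) (mem_Ioi.2 (h1.trans_le h2)) h2
  have h4 := h.deriv_pos h1
  have h5 := h.deriv_pos (h1.trans_le h2)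
  rw [becknerRate, becknerRate]
  gcongr

theorem superPoincareRate_of_lt (Φ : ℝ → ℝ) {s : ℝ} (hs : Real.exp 1 - 1 < s) :
    superPoincareRate Φ s = becknerRate Φ (1 / Real.log (1 + s)) := by
  rw [superPoincareRate, if_pos hs.le, becknerRate, one_div_one_div]

theorem superPoincareRate_of_le (Φ : ℝ → ℝ) {s : ℝ} (hs : s ≤ Real.exp 1 - 1) :
    superPoincareRate Φ s = becknerRate Φ 1 := by
  rw [superPoincareRate, becknerRate]
  split_ifs with h
  · rw [le_antisymm hs h, add_sub_cancel, Real.log_exp, div_one]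
  · rw [div_one]

end IsPotential

/-! ### Both inequalities on the product space -/

theorem mainTheorem5 (Φ : ℝ → ℝ) (hΦ : IsPotential Φ)
    (hC2 : ContDiffOn ℝ 2 Φ (Set.Ici (potentialInv Φ 1))) :
    ∃ C : ℝ, 0 < C ∧ ∀ n : ℕ, 1 ≤ n →
      BecknerInequality (potentialProd Φ n) (becknerRate Φ) C ∧
      SuperPoincareInequality (potentialProd Φ n)
        (fun s => 48 * C * superPoincareRate Φ s) := by
  obtain ⟨C, hC, hline⟩ := hΦ.beckner_line
  have hprob := hΦ.isProbabilityMeasure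
  refine ⟨C, hC, fun n _ => ?_⟩
  have hν : IsProbabilityMeasure (potentialProd Φ n) := by
    unfold potentialProd; infer_instance
  have hT : ∀ p ∈ Ioo (1 : ℝ) 2, 0 < becknerRate Φ (2 - p) := fun p hp =>
    hΦ.becknerRate_pos (by linarith [hp.2])
  have hbdd : ∀ p ∈ Ioo (1 : ℝ) 2, ∀ (f : (Fin n → ℝ) → ℝ) (M L : ℝ), IsBddC1 f M L →
      absMoment (potentialProd Φ n) 2 f ≤ absMoment (potentialProd Φ n) p f ^ (2 / p) +
        ENNReal.ofReal (C * becknerRate Φ (2 - p)) * energy (potentialProd Φ n) f := by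
    intro p hp f M L hf
    have hK := (mul_pos hC (hT p hp)).le
    exact hf.beckner hp.1.le hp.2.le hK
      (beckner_pi hp.1.le hp.2.le hK (hline p hp) n)
  refine ⟨fun f hf => iSup₂_le fun p hp => ?_, fun f hf s hs => ?_⟩
  · have hp0 : 0 < p := by linarith [hp.1]
    refine ENNReal.div_le_of_le_mul ?_
    rw [tsub_le_iff_left]
    have := le_of_forall_isBddC1 (mul_pos hC (hT p hp))
      (Ψ := fun f => absMoment (potentialProd Φ n) p f ^ (2 / p))
      (fun f g hfg => ENNReal.rpow_le_rpow (absMoment_mono hp0.le hfg) (by positivity))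
      (hbdd p hp) (hf.of_le (by exact_mod_cast le_top))
    rw [ENNReal.ofReal_mul hC.le] at this
    refine this.trans_eq ?_
    ring
  · rw [tsub_le_iff_left]
    have hs0 : 0 < s := by linarith
    have hβ : 0 < superPoincareRate Φ s := by
      rcases le_or_gt s (Real.exp 1 - 1) with h | h
      · rw [IsPotential.superPoincareRate_of_le Φ h]
        exact hΦ.becknerRate_pos one_pos
      · have := Real.exp_one_gt_d9
        rw [IsPotential.superPoincareRate_of_lt Φ h]
        exact hΦ.becknerRate_pos (one_div_pos.2 (Real.log_pos (by linarith)))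
    have hk : 0 < 48 * C * superPoincareRate Φ s := by positivity
    refine le_of_forall_isBddC1 hk
      (Ψ := fun f => ENNReal.ofReal s * absMoment (potentialProd Φ n) 1 f ^ 2)
      (fun f g hfg => by gcongr; exact absMoment_mono zero_le_one hfg) (fun f M L hf => ?_)
      (hf.of_le (by exact_mod_cast le_top))
    have h1 := absMoment_ne_top (ν := potentialProd Φ n) zero_le_one hf
    have h2 := absMoment_ne_top (ν := potentialProd Φ n) zero_le_two hf
    have hE := energy_ne_top (ν := potentialProd Φ n) hf
    have hint : ∀ p ∈ Ioo (1 : ℝ) 2, _ := fun p hp =>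
      toReal_absMoment_two_le hp.1.le hp.2.le (mul_pos hC (hT p hp)).le hf (hbdd p hp f M L hf)
    have hx := ENNReal.toReal_nonneg (a := absMoment (potentialProd Φ n) 2 f)
    have hy := ENNReal.toReal_nonneg (a := absMoment (potentialProd Φ n) 1 f)
    have hE0 := ENNReal.toReal_nonneg (a := energy (potentialProd Φ n) f)
    suffices hmain : (absMoment (potentialProd Φ n) 2 f).toReal ≤
        s * (absMoment (potentialProd Φ n) 1 f).toReal ^ 2 +
          48 * C * superPoincareRate Φ s * (energy (potentialProd Φ n) f).toReal by
      have h3 := ENNReal.ofReal_le_ofReal hmain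
      rwa [ENNReal.ofReal_add (by positivity) (by positivity), ENNReal.ofReal_mul hs0.le,
        ENNReal.ofReal_mul hk.le, ENNReal.ofReal_pow hy, ENNReal.ofReal_toReal h1,
        ENNReal.ofReal_toReal h2, ENNReal.ofReal_toReal hE] at h3
    rcases le_or_gt s (Real.exp 1 - 1) with h | h
    · rw [IsPotential.superPoincareRate_of_le Φ h]
      have hT1 := hΦ.becknerRate_pos one_pos
      -- Every T(2 - p) is at most T(1) = β(s); the limit gives level 1, hence level s ≥ 1.
      have h4 := le_of_interpolated_limit hx (sq_nonneg _)
        (by positivity : 0 ≤ C * becknerRate Φ 1 * (energy (potentialProd Φ n) f).toReal)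
        fun p hp => (hint p hp).trans (by
          gcongr
          exact hΦ.becknerRate_le_one (by linarith [hp.2]) (by linarith [hp.1]))
      have h5 := mul_le_mul_of_nonneg_right hs
        (sq_nonneg (absMoment (potentialProd Φ n) 1 f).toReal)
      have h6 : 0 ≤ C * becknerRate Φ 1 * (energy (potentialProd Φ n) f).toReal := by positivity
      linarith
    · have hl : 1 < Real.log (1 + s) := by
        rw [Real.lt_log_iff_exp_lt (by linarith)]; linarith
      have hl0 : 0 < 1 / Real.log (1 + s) := by positivity
      have hl1 : 1 / Real.log (1 + s) < 1 := (div_lt_one (by linarith)).2 hl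
      -- The exponent for which T(2 - p) = β(s); it lies in (1, 2) as log(1 + s) > 1.
      have h4 := hint (2 - 1 / Real.log (1 + s)) ⟨by linarith, by linarith⟩
      rw [sub_sub_cancel, ← IsPotential.superPoincareRate_of_lt Φ h] at h4
      have hp0 : 0 < 2 - 1 / Real.log (1 + s) := by linarith
      have h5 := le_of_interpolated hx (sq_nonneg _) (by positivity) h ?_ h4
      · linarith
      -- θ = (2 - p)/p ≥ (2 - p)/2, because p ≤ 2.
      · have e : 1 / (2 * Real.log (1 + s)) = 1 / Real.log (1 + s) / 2 := by ring
        rw [e]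
        exact div_le_div_of_nonneg_left hl0.le hp0 (by linarith)
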